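/- Let $(R,\mathfrak m)$ be a regular local ring of dimension $d\ge 2$ with field of fractions $K$, and let $x_1,\dots,x_d$ be elements with $\mathfrak m=(x_1,\dots,x_d)R$. Let $n\ge 1$ and let $R=R_0\subseteq R_1\subseteq\cdots\subseteq R_n$ be a sequence of monomial local quadratic transformations inside $K$. That is, put $x_{0,k}=x_k$; for each $i<n$ there is an index $j\in\{1,\dots,d\}$ such that, with $$x_{i+1,j}=x_{i,j},\qquad x_{i+1,k}=\frac{x_{i,k}}{x_{i,j}}\quad(k\ne j),$$ the ring $R_{i+1}$ is the localization of $R_i\bigl[\tfrac{x_{i,1}}{x_{i,j}},\dots,\tfrac{x_{i,d}}{x_{i,j}}\bigr]$ at its ideal $(x_{i+1,1},\dots,x_{i+1,d})$; we then say that the transform from $R_i$ to $R_{i+1}$ is in the $x_j$-direction. Each $R_i$ is a regular local ring with maximal ideal $(x_{i,1},\dots,x_{i,d})R_i$. Let $\mathfrak D_j$ be the set of $i\in\{0,\dots,n-1\}$ for which the transform from $R_i$ to $R_{i+1}$ is in the $x_j$-direction. For an ideal $I$ of a local ring $(T,\mathfrak n)$, let $\operatorname{ord}_T(I)$ be the integer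 $r$ with $I\subseteq\mathfrak n^r$ and $I\not\subseteq\mathfrak n^{r+1}$, and put $\operatorname{ord}_T(f)=\operatorname{ord}_T(fT)$. For unique factorization domains $R\subseteq T$ with the same field of fractions and a height-one prime $p$ of $R$, let the transform $p^T$ be the unique height-one prime $q$ of $T$ with $q\cap R=p$ if $pT\cap R=p$, and $p^T=T$ otherwise. A nonzero ideal $I$ of $R$ factors uniquely as $I=p_1^{a_1}\cdots p_m^{a_m}J$ with distinct nonzero principal primes $p_i$, integers $a_i\ge1$, and an ideal $J$ with $J^{-1}=R$; its transform is $I^T=(p_1^T)^{a_1}\cdots(p_m^T)^{a_m}\,(JT)(JT)^{-1}$. Then the following are equivalent: 1. the sets $\mathfrak D_1,\dots,\mathfrak D_d$ are all nonempty; 2. for every nonzero $f\in\mathfrak m$, $\operatorname{ord}_{R_n}\bigl((fR)^{R_n}\bigr)<\operatorname{ord}_R(f)$. -/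

import Mathlib

namespace MonomialLQT

noncomputable section

open scoped nonZeroDivisors Classical

/-- The order of an ideal `I` of a local ring `(R, 𝔪)`: the `r` with `I ⊆ 𝔪 ^ r` and
`I ⊄ 𝔪 ^ (r + 1)`, and `⊤` if `I` lies in every power of `𝔪` (as for `I = 0`). -/
def ord {R : Type*} [CommRing R] [IsLocalRing R] (I : Ideal R) : ℕ∞ :=
  ⨆ r ∈ {r : ℕ | I ≤ IsLocalRing.maximalIdeal R ^ r}, (r : ℕ∞)

/-- The transform in `T` of a height-one prime `p` of `R`: the unique height-one prime `q` of `T`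
with `q ∩ R = p` if `pT ∩ R = p`, and the unit ideal otherwise. -/
def transformPrime {R : Type*} (T : Type*) [CommRing R] [CommRing T] [Algebra R T]
    (p : Ideal R) : Ideal T :=
  if (p.map (algebraMap R T)).comap (algebraMap R T) = p then
    sInf {q : Ideal T | q.IsPrime ∧ q.height = 1 ∧ q.comap (algebraMap R T) = p}
  else ⊤

/-- The nonzero principal prime ideals of `R`. -/
def principalPrimes (R : Type*) [CommRing R] : Set (Ideal R) :=
  {p | p.IsPrime ∧ p.IsPrincipal ∧ p ≠ ⊥}

/-- The exponent `a` of `p` in the factorization `I = p₁ ^ a₁ ⋯ pₙ ^ aₙ J`: the largest `a` with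
`I ⊆ p ^ a`. -/
def exponent {R : Type*} [CommRing R] (I p : Ideal R) : ℕ :=
  sSup {a : ℕ | I ≤ p ^ a}

/-- The factor `J` in the factorization `I = p₁ ^ a₁ ⋯ pₙ ^ aₙ J`, as the ideal quotient
`(I : p₁ ^ a₁ ⋯ pₙ ^ aₙ)`. -/
def residualFactor {R : Type*} [CommRing R] (I : Ideal R) : Ideal R :=
  I.colon ((∏ᶠ p ∈ principalPrimes R, p ^ exponent I p : Ideal R) : Set R)

/-- The ideal `J J⁻¹` of a domain `T`, where `J⁻¹` is taken in the field of fractions. -/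
def mulInv {T : Type*} [CommRing T] [IsDomain T] (J : Ideal T) : Ideal T :=
  (((J : FractionalIdeal T⁰ (FractionRing T)) * (J : FractionalIdeal T⁰ (FractionRing T))⁻¹ :
    FractionalIdeal T⁰ (FractionRing T)) : Submodule T (FractionRing T)).comap
      (Algebra.linearMap T (FractionRing T))

/-- The transform `q₁ ^ a₁ ⋯ qₙ ^ aₙ (JT)(JT)⁻¹` in `T` of a nonzero ideal
`I = p₁ ^ a₁ ⋯ pₙ ^ aₙ J` of `R`, where the `pᵢ` are principal primes with transforms `qᵢ`
and `J⁻¹ = R`. It is meant for factorial domains `R ⊆ T` with the same field of fractions. -/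
def transform {R : Type*} (T : Type*) [CommRing R] [CommRing T] [IsDomain T] [Algebra R T]
    (I : Ideal R) : Ideal T :=
  (∏ᶠ p ∈ principalPrimes R, transformPrime T p ^ exponent I p) *
    mulInv ((residualFactor I).map (algebraMap R T))

section

variable {R K ι : Type*} [CommRing R] [Field K] [Algebra R K]

/-- The ring `A[u₁ / uⱼ, …, u_d / uⱼ]`. -/
def chart (A : Subalgebra R K) (u : ι → K) (j : ι) : Subalgebra R K :=
  Algebra.adjoin R ((A : Set K) ∪ Set.range fun k => u k / u j)

/-- `(B, v)` is the monomial local quadratic transformation of `(A, u)` in the direction of the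
`j`-th variable: `vⱼ = uⱼ` and `vₖ = uₖ / uⱼ` for `k ≠ j`, and `B` is the localization of
`A[u₁ / uⱼ, …, u_d / uⱼ]` at its ideal generated by `v₁, …, v_d`. -/
def IsMonomialTransform (A : Subalgebra R K) (u : ι → K) (B : Subalgebra R K) (v : ι → K)
    (j : ι) : Prop :=
  (∀ k, v k = if k = j then u j else u k / u j) ∧
  ∀ z : K, z ∈ B ↔ ∃ a b : chart A u j,
    b ∉ Ideal.span {s : chart A u j | (s : K) ∈ Set.range v} ∧ z = (a : K) / (b : K)

/-- The set of indices `i` such that the step from `A i` to `A (i + 1)` is in the direction of the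
`j`-th variable. -/
def directionSet {n : ℕ} (A : Fin (n + 1) → Subalgebra R K) (u : Fin (n + 1) → ι → K) (j : ι) :
    Set (Fin n) :=
  {i | IsMonomialTransform (A i.castSucc) (u i.castSucc) (A i.succ) (u i.succ) j}

end

end

end MonomialLQT

/-! Everything rests on monomial valuations. The parameters `x` of a regular local ring are
quasi-regular: a form in `x` of degree `s` that falls into the `(s + 1)`-st power of the maximal
ideal has all its coefficients in the maximal ideal. This extends to weighted forms, and since
polynomials over the residue field form a domain, any positive weights on `x` define a valuation of
`K`. A valuation that is nonnegative on a ring and at least `1` on its parameters bounds orders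
there: an element of value `k` cannot lie in the `(k + 1)`-st power of the maximal ideal.

Suppose that all directions occur. Choose the weights so that every variable of the last ring has
value `1`, and expand a prime factor `p` of `f` as a sum of monomials of weight at least the value
of `p`. Rewriting the monomials step by step and extracting the largest common power of the
exceptional variable gives `p = (monomial) * g`. A monomial of least degree loses degree at the
first extraction whose direction it involves, unless the least degree has already dropped; so the
value of `g` ends below some `r` for which `p` lies in the `r`-th power of the maximal ideal
(`exists_monomial_factorization`, `exists_eq_monomialValue_mul`). Moreover `g` lies in the transform
of `(p)`, because a prime over `(p)` containing a last variable would force `(p) = (x k)`, and no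
prime of the last ring lies over `(x k)` once direction `k` has been used
(`comap_ne_span_of_dir_eq`). Multiplying over the prime factors bounds the order of the transform of
`f`.

Suppose that direction `l` is missing. Then the weight of `x l` can be raised by any `N` while the
valuation stays nonnegative on every ring of the sequence. Letting `N` grow puts the last ring
inside the localization of `R` at `(x l)`. The center of that localization is a height-one prime
over `(x l)`, so the transform of `(x l)` is proper and has order at least `1`, the order of `x l`.
-/

section

/-! ### Regular local rings: ideals generated by parameters -/

open IsLocalRing

/-- A Noetherian local ring whose maximal ideal is generated by at most `dim R` elements
is a domain. -/
theorem isDomain_of_card_le_ringKrullDim (n : ℕ) : ∀ (R : Type*) [CommRing R] [IsLocalRing R]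
    [IsNoetherianRing R] (S : Finset R), Ideal.span (S : Set R) = maximalIdeal R →
    S.card ≤ n → (n : WithBot ℕ∞) ≤ ringKrullDim R → IsDomain R := by
  induction n with
  | zero =>
    intro R _ _ _ S hS hc _
    have h0 : maximalIdeal R = ⊥ := by
      rw [← hS, Finset.card_eq_zero.mp (Nat.le_zero.mp hc)]; simp
    exact ((isField_iff_maximalIdeal_eq).mpr h0).isDomain
  | succ n ih =>
    intro R _ _ _ S hS hc hdim
    classical
    have hnot : ∀ P ∈ minimalPrimes R, ¬ maximalIdeal R ≤ P := by
      intro P hP hle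
      have hPp : P.IsPrime := hP.1.1
      have hPm : P = maximalIdeal R := le_antisymm (le_maximalIdeal hPp.ne_top) hle
      have hh : P.height = 0 := Ideal.height_eq_zero_iff.mpr hP
      have := maximalIdeal_height_eq_ringKrullDim (R := R)
      rw [← hPm, hh] at this
      rw [← this] at hdim
      have : ((n + 1 : ℕ) : ℕ∞) ≤ 0 := by exact_mod_cast hdim
      simp at this
    have hsq : ¬ maximalIdeal R ≤ maximalIdeal R ^ 2 := by
      refine (IsLocalRing.maximalIdeal_sq_lt_of_ringKrullDim_ne_zero (R := R) ?_).not_ge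
      exact (lt_of_lt_of_le (by exact_mod_cast Nat.succ_pos n) hdim).ne'
    have hfin := minimalPrimes.finite_of_isNoetherianRing R
    -- Prime avoidance, with the square of the maximal ideal as the one member of the family that
    -- need not be prime.
    obtain ⟨z, hzm, hz⟩ : ∃ z ∈ maximalIdeal R, z ∉ maximalIdeal R ^ 2 ∧
        ∀ P ∈ minimalPrimes R, z ∉ P := by
      by_contra! hcon
      have := (Ideal.subset_union_prime (s := insert (maximalIdeal R ^ 2) hfin.toFinset)
        (f := id) (I := maximalIdeal R) (maximalIdeal R ^ 2) (maximalIdeal R ^ 2) (by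
          intro i hi hne _
          simp only [Finset.mem_insert, Set.Finite.mem_toFinset] at hi
          exact (hi.resolve_left hne).1.1)).mp (by
          intro z hz
          by_cases h2 : z ∈ maximalIdeal R ^ 2
          · simp [h2]
          · obtain ⟨P, hP, hzP⟩ := hcon z hz h2
            simp only [Set.mem_iUnion]
            exact ⟨P, by simp [hP], hzP⟩)
      obtain ⟨i, hi, hle⟩ := this
      simp only [Finset.mem_insert, Set.Finite.mem_toFinset] at hi
      rcases hi with rfl | hi
      · exact hsq hle
      · exact hnot i hi hle
    obtain ⟨hz2, hzP⟩ := hz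
    have hzS := hzm
    rw [← hS, Submodule.mem_span_finset] at hzS
    obtain ⟨c, -, hc'⟩ := hzS
    -- As `z` is not in the square, one coefficient is a unit. The generator `t` becomes redundant
    -- modulo `z`, so the quotient satisfies the induction hypothesis.
    obtain ⟨t, htS, ht⟩ : ∃ t ∈ S, IsUnit (c t) := by
      by_contra! hcon
      apply hz2
      rw [← hc', pow_two]
      refine Ideal.sum_mem _ fun t ht => Ideal.mul_mem_mul ((mem_maximalIdeal _).mpr (hcon t ht)) ?_
      rw [← hS]; exact Ideal.subset_span ht
    set I := Ideal.span {z}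
    have hI : I ≤ maximalIdeal R := (Ideal.span_singleton_le_iff_mem _).mpr hzm
    have hIt : I ≠ ⊤ := fun h => (maximalIdeal.isMaximal R).ne_top (top_le_iff.mp (h ▸ hI))
    have : Nontrivial (R ⧸ I) := Ideal.Quotient.nontrivial_iff.mpr hIt
    have : IsLocalRing (R ⧸ I) :=
      IsLocalRing.of_surjective' (Ideal.Quotient.mk I) Ideal.Quotient.mk_surjective
    have hdom : IsDomain (R ⧸ I) := by
      refine ih (R ⧸ I) ((S.erase t).image (Ideal.Quotient.mk I)) ?_ ?_ ?_
      · have hmap : (maximalIdeal R).map (Ideal.Quotient.mk I) = maximalIdeal (R ⧸ I) :=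
          IsLocalRing.map_maximalIdeal_of_surjective _ Ideal.Quotient.mk_surjective
        rw [← hmap, ← hS, Ideal.map_span, Finset.coe_image]
        refine le_antisymm (Ideal.span_mono (Set.image_mono (by simp))) ?_
        rw [Ideal.span_le]
        rintro _ ⟨s, hs, rfl⟩
        by_cases hst : s = t
        · subst hst
          have h1 : c s * s = z - ∑ a ∈ S.erase s, c a * a := by
            rw [← hc', ← Finset.add_sum_erase S _ hs]; simp
          have h2 : Ideal.Quotient.mk I (c s * s) ∈ Ideal.span
              (Ideal.Quotient.mk I '' (S.erase s : Finset R)) := by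
            rw [h1, map_sub, map_sum, Ideal.Quotient.eq_zero_iff_mem.mpr
              (Ideal.mem_span_singleton_self z), zero_sub]
            refine neg_mem (Ideal.sum_mem _ fun a ha => ?_)
            rw [map_mul]
            exact Ideal.mul_mem_left _ _ (Ideal.subset_span ⟨a, ha, rfl⟩)
          rw [map_mul] at h2
          exact (Ideal.unit_mul_mem_iff_mem _ (ht.map _)).mp h2
        · exact Ideal.subset_span ⟨s, by simp [hst, Finset.mem_coe.mp hs], rfl⟩
      · refine Finset.card_image_le.trans ?_
        rw [Finset.card_erase_of_mem htS]; omega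
      · have h := ringKrullDim_le_ringKrullDim_quotient_add_card (R := R) {z} (by
          simpa [IsLocalRing.ringJacobson_eq_maximalIdeal] using hzm)
        have h2 := hdim.trans h
        rw [Finset.coe_singleton, Finset.card_singleton, Nat.cast_succ] at h2
        exact (ENat.WithBot.add_le_add_natCast_right_iff (c := 1)).mp (by simpa using h2)
    have hprime : I.IsPrime := (Ideal.Quotient.isDomain_iff_prime I).mp hdom
    obtain ⟨P, hP, hPI⟩ := Ideal.exists_minimalPrimes_le (I := ⊥) (J := I) bot_le
    have hPm : P ∈ minimalPrimes R := hP
    have hPp : P.IsPrime := hPm.1.1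
    -- Here `z` generates a prime containing the minimal prime `P` but is not in `P`, so dividing an
    -- element of `P` by `z` stays in `P`; Nakayama then gives `P = 0`.
    have hPe : P ≤ I * P := by
      intro p hp
      obtain ⟨r, rfl⟩ := Ideal.mem_span_singleton'.mp (hPI hp)
      exact mul_comm r z ▸ Ideal.mul_mem_mul (Ideal.mem_span_singleton_self z)
        ((hPp.mem_or_mem hp).resolve_right (hzP P hPm))
    have hbot : P = ⊥ := by
      refine Submodule.eq_bot_of_le_smul_of_le_jacobson_bot I P (IsNoetherian.noetherian P) hPe ?_
      rw [IsLocalRing.jacobson_eq_maximalIdeal ⊥ bot_ne_top]; exact hI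
    subst hbot
    exact IsDomain.of_bot_isPrime R

/-- Krull's intersection theorem in `R ⧸ I`. It replaces completeness in the successive
approximations below. -/
theorem Ideal.mem_of_forall_mem_sup_pow_maximalIdeal {R : Type*} [CommRing R] [IsLocalRing R]
    [IsNoetherianRing R] {I : Ideal R} {a : R} (h : ∀ N, a ∈ I ⊔ maximalIdeal R ^ N) : a ∈ I := by
  by_cases hI : I = ⊤
  · rw [hI]; trivial
  have : Nontrivial (R ⧸ I) := Ideal.Quotient.nontrivial_iff.mpr hI
  have : IsLocalRing (R ⧸ I) :=
    IsLocalRing.of_surjective' (Ideal.Quotient.mk I) Ideal.Quotient.mk_surjective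
  have hmap : (maximalIdeal R).map (Ideal.Quotient.mk I) = maximalIdeal (R ⧸ I) :=
    IsLocalRing.map_maximalIdeal_of_surjective _ Ideal.Quotient.mk_surjective
  rw [← Ideal.Quotient.eq_zero_iff_mem, ← Ideal.mem_bot, ← Ideal.iInf_pow_eq_bot_of_isLocalRing
    (maximalIdeal (R ⧸ I)) (maximalIdeal.isMaximal _).ne_top, Ideal.mem_iInf]
  intro N
  rw [← hmap, ← Ideal.map_pow]
  obtain ⟨b, hb, c, hc, rfl⟩ := Submodule.mem_sup.mp (h N)
  rw [map_add, Ideal.Quotient.eq_zero_iff_mem.mpr hb, zero_add]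
  exact Ideal.mem_map_of_mem _ hc

section

variable {R ι : Type*} [CommRing R] [IsLocalRing R] [IsNoetherianRing R] [Fintype ι]
  {x : ι → R}

/-- Each parameter killed lowers the dimension by at most one, so the quotient still has at least as
large a dimension as the number of parameters left to generate its maximal ideal. -/
theorem isPrime_span_image_parameters (hx : Ideal.span (Set.range x) = maximalIdeal R)
    (hdim : (Fintype.card ι : WithBot ℕ∞) ≤ ringKrullDim R) (T : Finset ι) :
    (Ideal.span (x '' T)).IsPrime := by
  classical
  set I := Ideal.span (x '' T)
  have hI : I ≤ maximalIdeal R := by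
    rw [← hx]; exact Ideal.span_mono (Set.image_subset_range _ _)
  have hIt : I ≠ ⊤ := fun h => (maximalIdeal.isMaximal R).ne_top (top_le_iff.mp (h ▸ hI))
  have : Nontrivial (R ⧸ I) := Ideal.Quotient.nontrivial_iff.mpr hIt
  have : IsLocalRing (R ⧸ I) :=
    IsLocalRing.of_surjective' (Ideal.Quotient.mk I) Ideal.Quotient.mk_surjective
  have hmap : (maximalIdeal R).map (Ideal.Quotient.mk I) = maximalIdeal (R ⧸ I) :=
    IsLocalRing.map_maximalIdeal_of_surjective _ Ideal.Quotient.mk_surjective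
  rw [← Ideal.Quotient.isDomain_iff_prime]
  refine isDomain_of_card_le_ringKrullDim (Tᶜ).card (R ⧸ I)
    (Tᶜ.image fun i => Ideal.Quotient.mk I (x i)) ?_ Finset.card_image_le ?_
  · rw [← hmap, ← hx, Ideal.map_span]
    refine le_antisymm (Ideal.span_mono ?_) ?_
    · intro y hy
      obtain ⟨i, -, rfl⟩ := Finset.mem_image.mp (Finset.mem_coe.mp hy)
      exact ⟨x i, ⟨i, rfl⟩, rfl⟩
    · rw [Ideal.span_le]
      rintro _ ⟨_, ⟨i, rfl⟩, rfl⟩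
      by_cases hi : i ∈ T
      · rw [Ideal.Quotient.eq_zero_iff_mem.mpr (show x i ∈ I from Ideal.subset_span ⟨i, hi, rfl⟩)]
        exact zero_mem _
      · exact Ideal.subset_span (Finset.mem_coe.mpr
          (Finset.mem_image_of_mem _ (Finset.mem_compl.mpr hi)))
  · have h := ringKrullDim_le_ringKrullDim_quotient_add_card (R := R) (T.image x) (by
      rw [IsLocalRing.ringJacobson_eq_maximalIdeal, Finset.coe_image]
      exact Ideal.subset_span.trans hI)
    rw [Finset.coe_image] at h
    have h2 : ((Tᶜ.card : WithBot ℕ∞) + T.card) ≤ ringKrullDim (R ⧸ I) + T.card := by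
      refine le_trans ?_ (hdim.trans (h.trans (by gcongr; exact Finset.card_image_le)))
      rw [← Finset.card_add_card_compl T]; push_cast; rw [add_comm]
    exact (ENat.WithBot.add_le_add_natCast_right_iff).mp h2

/-- Otherwise `x j` could be dropped, and the maximal ideal would have fewer generators than the
dimension. -/
theorem parameter_notMem_span_image (hx : Ideal.span (Set.range x) = maximalIdeal R)
    (hdim : (Fintype.card ι : WithBot ℕ∞) ≤ ringKrullDim R) {T : Finset ι} {j : ι} (hj : j ∉ T) :
    x j ∉ Ideal.span (x '' T) := by
  classical
  intro hmem
  have hm : maximalIdeal R = Ideal.span ((Finset.univ.erase j).image x : Finset R) := by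
    rw [← hx]
    refine le_antisymm ?_ (Ideal.span_mono (by simp))
    rw [Ideal.span_le]
    rintro _ ⟨i, rfl⟩
    by_cases hi : i = j
    · subst hi
      refine Ideal.span_mono ?_ hmem
      rintro _ ⟨k, hk, rfl⟩
      rw [Finset.mem_coe, Finset.mem_image]
      refine ⟨k, ?_, rfl⟩
      rw [Finset.mem_erase]
      exact ⟨fun h => hj (h ▸ Finset.mem_coe.mp hk), Finset.mem_univ k⟩
    · exact Ideal.subset_span (Finset.mem_coe.mpr (Finset.mem_image_of_mem x
        (Finset.mem_erase.mpr ⟨hi, Finset.mem_univ i⟩)))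
  have h1 := ringKrullDim_le_spanFinrank_maximalIdeal R
  have h2 : (maximalIdeal R).spanFinrank ≤ (Finset.univ.erase j).card := by
    rw [hm]
    refine (Submodule.spanFinrank_span_le_ncard_of_finite (Finset.finite_toSet _)).trans ?_
    rw [Set.ncard_coe_finset]; exact Finset.card_image_le
  have h3 := hdim.trans h1
  have h4 : Fintype.card ι ≤ (maximalIdeal R).spanFinrank := by exact_mod_cast h3
  have h5 : (Finset.univ.erase j).card < Fintype.card ι :=
    Finset.card_erase_lt_of_mem (Finset.mem_univ j)
  omega

end

end

/-! ### Monomials in the parameters and quasi-regularity -/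

section

open IsLocalRing MvPolynomial

/-- The value at `x` of the monomial with exponent `a`. -/
def monomialValue {S ι : Type*} [CommMonoid S] [Fintype ι] (x : ι → S) (a : ι →₀ ℕ) : S :=
  ∏ i, x i ^ a i

section

variable {R ι : Type*} [CommRing R] [Fintype ι] {x : ι → R}

theorem monomialValue_add (a b : ι →₀ ℕ) :
    monomialValue x (a + b) = monomialValue x a * monomialValue x b := by
  simp [monomialValue, pow_add, Finset.prod_mul_distrib]

theorem monomialValue_single (i : ι) : monomialValue x (Finsupp.single i 1) = x i := by
  classical
  rw [monomialValue, Finset.prod_eq_single i] <;> simp +contextual [eq_comm]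

theorem monomialValue_zero : monomialValue x 0 = 1 := by simp [monomialValue]

theorem eval_eq_sum_monomialValue (P : MvPolynomial ι R) :
    eval x P = ∑ a ∈ P.support, coeff a P * monomialValue x a := eval_eq' x P

theorem eval_monomial_eq (a : ι →₀ ℕ) (c : R) :
    eval x (monomial a c) = c * monomialValue x a := by
  rw [eval_monomial, monomialValue, Finsupp.prod_fintype _ _ (by simp)]

theorem monomialValue_eq_mul {a b : ι →₀ ℕ} (h : b ≤ a) :
    monomialValue x a = monomialValue x b * monomialValue x (a - b) := by
  rw [← monomialValue_add, add_tsub_cancel_of_le h]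

theorem exists_eval_eq_of_mem_span_monomialValue {B : Set (ι →₀ ℕ)} {z : R}
    (hz : z ∈ Ideal.span (monomialValue x '' B)) :
    ∃ P : MvPolynomial ι R, (∀ a ∈ P.support, a ∈ B) ∧ eval x P = z := by
  induction hz using Submodule.span_induction with
  | mem z hz =>
    obtain ⟨a, ha, rfl⟩ := hz
    refine ⟨monomial a 1, fun b hb => ?_, by simp [eval_monomial_eq]⟩
    have := Finset.mem_singleton.mp (support_monomial_subset hb)
    rwa [this]
  | zero => exact ⟨0, by simp, by simp⟩
  | add y z _ _ hy hz =>
    classical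
    obtain ⟨P, hP, rfl⟩ := hy
    obtain ⟨Q, hQ, rfl⟩ := hz
    refine ⟨P + Q, fun a ha => ?_, by simp⟩
    rcases Finset.mem_union.mp (support_add ha) with h | h
    exacts [hP a h, hQ a h]
  | smul r z _ hz =>
    obtain ⟨P, hP, rfl⟩ := hz
    exact ⟨r • P, fun a ha => hP a (support_smul ha), by simp⟩

theorem eval_mem_span_monomialValue {B : Set (ι →₀ ℕ)} {P : MvPolynomial ι R}
    (hP : ∀ a ∈ P.support, a ∈ B) : eval x P ∈ Ideal.span (monomialValue x '' B) := by
  rw [eval_eq_sum_monomialValue]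
  exact Ideal.sum_mem _ fun a ha => Ideal.mul_mem_left _ _ (Ideal.subset_span ⟨a, hP a ha, rfl⟩)

theorem span_range_pow_eq (s : ℕ) :
    Ideal.span (Set.range x) ^ s = Ideal.span (monomialValue x '' {a | a.degree = s}) := by
  apply le_antisymm
  · induction s with
    | zero =>
      rw [pow_zero, Ideal.one_eq_top, top_le_iff, Ideal.eq_top_iff_one]
      exact Ideal.subset_span ⟨0, by simp, monomialValue_zero⟩
    | succ s ih =>
      rw [pow_succ]
      refine (Ideal.mul_mono_left ih).trans ?_
      rw [Ideal.span_mul_span']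
      refine Ideal.span_mono ?_
      rintro _ ⟨_, ⟨a, ha, rfl⟩, _, ⟨i, rfl⟩, rfl⟩
      refine ⟨a + Finsupp.single i 1, ?_, by simp [monomialValue_add, monomialValue_single]⟩
      have ha' : a.degree = s := ha
      simp [ha']
  · rw [Ideal.span_le]
    rintro _ ⟨a, ha, rfl⟩
    have ha' : a.degree = s := ha
    rw [← ha', Finsupp.degree_eq_sum, ← Finset.prod_pow_eq_pow_sum, SetLike.mem_coe]
    exact Ideal.prod_mem_prod fun i _ => Ideal.pow_mem_pow (Ideal.subset_span (Set.mem_range_self i)) _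

end

theorem MvPolynomial.isHomogeneous_of_degree_eq {R ι : Type*} [CommRing R] {P : MvPolynomial ι R}
    {s : ℕ} (hP : ∀ a, coeff a P ≠ 0 → a.degree = s) : P.IsHomogeneous s := by
  intro a ha
  have := hP a ha
  rwa [Finsupp.degree_eq_weight_one] at this

theorem MvPolynomial.IsHomogeneous.degree_eq_of_mem_support {R ι : Type*} [CommRing R]
    {P : MvPolynomial ι R} {s : ℕ}
    (hP : P.IsHomogeneous s) {a : ι →₀ ℕ} (ha : a ∈ P.support) : a.degree = s := by
  by_contra h
  exact (mem_support_iff.mp ha) (hP.coeff_eq_zero h)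

theorem span_image_compl_le {R ι : Type*} [CommRing R] {x : ι → R} (S : Finset ι) [DecidableEq ι]
    (j : ι) :
    Ideal.span (x '' ((insert j S : Finset ι) : Set ι)ᶜ) ≤ Ideal.span (x '' (S : Set ι)ᶜ) :=
  Ideal.span_mono (Set.image_mono (Set.compl_subset_compl.mpr (by simp)))

section

variable {R ι : Type*} [CommRing R] [IsLocalRing R] [Fintype ι] {x : ι → R}

theorem monomialValue_mem_pow (hx : Ideal.span (Set.range x) = maximalIdeal R) (a : ι →₀ ℕ) :
    monomialValue x a ∈ maximalIdeal R ^ a.degree := by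
  rw [← hx, span_range_pow_eq]; exact Ideal.subset_span ⟨a, rfl, rfl⟩

theorem exists_isHomogeneous_eval_eq (hx : Ideal.span (Set.range x) = maximalIdeal R) {s : ℕ}
    {z : R} (hz : z ∈ maximalIdeal R ^ s) :
    ∃ P : MvPolynomial ι R, P.IsHomogeneous s ∧ eval x P = z := by
  rw [← hx, span_range_pow_eq] at hz
  obtain ⟨P, hP, h⟩ := exists_eval_eq_of_mem_span_monomialValue hz
  exact ⟨P, isHomogeneous_of_degree_eq fun a ha => hP a (mem_support_iff.mpr ha), h⟩

theorem eval_mem_pow_succ (hx : Ideal.span (Set.range x) = maximalIdeal R) {P : MvPolynomial ι R}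
    {s : ℕ} (hP : P.IsHomogeneous s) (hc : ∀ a, coeff a P ∈ maximalIdeal R) :
    eval x P ∈ maximalIdeal R ^ (s + 1) := by
  rw [eval_eq_sum_monomialValue]
  refine Ideal.sum_mem _ fun a ha => ?_
  rw [← hP.degree_eq_of_mem_support ha, pow_succ']
  exact Ideal.mul_mem_mul (hc a) (monomialValue_mem_pow hx a)

/-- Independence modulo the parameters outside `S` of the monomials in the parameters in `S`. -/
def QuasiRegularOn (x : ι → R) (S : Finset ι) : Prop :=
  ∀ (s : ℕ) (F : MvPolynomial ι R), F.IsHomogeneous s →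
    (∀ a ∈ F.support, ∀ i ∉ S, a i = 0) →
    eval x F ∈ maximalIdeal R ^ (s + 1) ⊔ Ideal.span (x '' (S : Set ι)ᶜ) →
    ∀ a, coeff a F ∈ maximalIdeal R

theorem quasiRegularOn_empty (hx : Ideal.span (Set.range x) = maximalIdeal R) :
    QuasiRegularOn x (∅ : Finset ι) := by
  intro s F _ hF hev a
  have h0 : ∀ a ∈ F.support, a = 0 := fun a ha => by
    ext i; exact hF a ha i (by simp)
  by_cases ha : a ∈ F.support
  · obtain rfl := h0 a ha
    have hsup : F.support = {0} := by
      ext b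
      rw [Finset.mem_singleton]
      exact ⟨h0 b, fun h => h ▸ ha⟩
    rw [eval_eq_sum_monomialValue, hsup, Finset.sum_singleton, monomialValue_zero, mul_one] at hev
    have hle : Ideal.span (x '' ((∅ : Finset ι) : Set ι)ᶜ) ≤ maximalIdeal R := by
      rw [← hx]; exact Ideal.span_mono (Set.image_subset_range _ _)
    exact (sup_le (Ideal.pow_le_self (Nat.succ_ne_zero s)) hle :
      maximalIdeal R ^ (s + 1) ⊔ _ ≤ _) hev
  · rw [notMem_support_iff.mp ha]; exact zero_mem _

/-- Modulo the parameters outside `S ∪ {j}`, a form of degree `s + 1` is the sum of its part in the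
variables in `S` and a multiple of `x j`. -/
theorem exists_restrict (hx : Ideal.span (Set.range x) = maximalIdeal R) (S T : Finset ι) (j : ι)
    (hT : ∀ i, i ∈ T → i = j ∨ i ∈ S) {s : ℕ} {E : MvPolynomial ι R} (hE : E.IsHomogeneous (s + 1)) :
    ∃ E₀ : MvPolynomial ι R, E₀.IsHomogeneous (s + 1) ∧ (∀ a ∈ E₀.support, ∀ i ∉ S, a i = 0) ∧
      ∃ g ∈ maximalIdeal R ^ s, ∃ r ∈ Ideal.span (x '' (T : Set ι)ᶜ),
        eval x E = eval x E₀ + x j * g + r := by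
  classical
  set p : (ι →₀ ℕ) → Prop := fun a => ∀ i ∉ S, a i = 0
  refine ⟨∑ a ∈ E.support with p a, monomial a (coeff a E), ?_, ?_, ?_⟩
  · refine IsHomogeneous.sum _ _ _ fun a ha => isHomogeneous_monomial _ ?_
    exact hE.degree_eq_of_mem_support (Finset.mem_filter.mp ha).1
  · intro a ha
    obtain ⟨b, hb, hab⟩ := Finset.mem_biUnion.mp (support_sum ha)
    rw [Finset.mem_singleton.mp (support_monomial_subset hab)]
    exact (Finset.mem_filter.mp hb).2
  · have hsplit : eval x E = eval x (∑ a ∈ E.support with p a, monomial a (coeff a E)) +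
        ∑ a ∈ E.support with ¬ p a, coeff a E * monomialValue x a := by
      rw [map_sum, eval_eq_sum_monomialValue, ← Finset.sum_filter_add_sum_filter_not _ p]
      congr 1
      exact Finset.sum_congr rfl fun a _ => (eval_monomial_eq a _).symm
    have hrest : (∑ a ∈ E.support with ¬ p a, coeff a E * monomialValue x a) ∈
        Ideal.span {x j} * maximalIdeal R ^ s ⊔ Ideal.span (x '' (T : Set ι)ᶜ) := by
      refine Ideal.sum_mem _ fun a ha => Ideal.mul_mem_left _ _ ?_
      obtain ⟨haE, hpa⟩ := Finset.mem_filter.mp ha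
      simp only [p, not_forall] at hpa
      obtain ⟨i, hiS, hi⟩ := hpa
      have hle : Finsupp.single i 1 ≤ a := by
        rw [Finsupp.single_le_iff]; omega
      have hdeg : (a - Finsupp.single i 1).degree = s := by
        have h1 := hE.degree_eq_of_mem_support haE
        rw [← add_tsub_cancel_of_le hle, map_add, Finsupp.degree_single] at h1
        omega
      rw [monomialValue_eq_mul hle, monomialValue_single]
      by_cases hiT : i ∈ T
      · obtain rfl := (hT i hiT).resolve_right hiS
        refine Ideal.mem_sup_left (Ideal.mul_mem_mul (Ideal.mem_span_singleton_self _) ?_)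
        rw [← hdeg]; exact monomialValue_mem_pow hx _
      · exact Ideal.mem_sup_right (Ideal.mul_mem_right _ _ (Ideal.subset_span ⟨i, hiT, rfl⟩))
    obtain ⟨u, hu, r, hr, hur⟩ := Submodule.mem_sup.mp hrest
    obtain ⟨g, hg, rfl⟩ := Ideal.mem_span_singleton_mul.mp hu
    exact ⟨g, hg, r, hr, by rw [hsplit, ← hur, add_assoc]⟩

/-- Cancellation of `x j` in the associated graded ring modulo the remaining parameters. An error
term of `x j * (h - h')` is a form; its part in the variables of `S` has coefficients in the maximal
ideal by `hS`, hence has higher order, and the rest is absorbed by correcting `h'`. In the limit `x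
j * h` equals `x j * h'` modulo a prime ideal that does not contain `x j`. -/
theorem mem_pow_sup_of_mul_mem [IsNoetherianRing R] [DecidableEq ι]
    (hx : Ideal.span (Set.range x) = maximalIdeal R)
    {S : Finset ι} {j : ι} (hjS : j ∉ S) (hS : QuasiRegularOn x S)
    (hp : (Ideal.span (x '' ((insert j S : Finset ι) : Set ι)ᶜ)).IsPrime)
    (hj : x j ∉ Ideal.span (x '' ((insert j S : Finset ι) : Set ι)ᶜ)) {t : ℕ} {h : R}
    (hh : x j * h ∈ maximalIdeal R ^ (t + 1) ⊔
      Ideal.span (x '' ((insert j S : Finset ι) : Set ι)ᶜ)) :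
    h ∈ maximalIdeal R ^ t ⊔ Ideal.span (x '' ((insert j S : Finset ι) : Set ι)ᶜ) := by
  set I := Ideal.span (x '' ((insert j S : Finset ι) : Set ι)ᶜ)
  have hjJ : x j ∈ Ideal.span (x '' (S : Set ι)ᶜ) := Ideal.subset_span ⟨j, by simpa using hjS, rfl⟩
  have key : ∀ N, ∃ h' ∈ maximalIdeal R ^ t, x j * (h - h') ∈ maximalIdeal R ^ (t + N + 1) ⊔ I := by
    intro N
    induction N with
    | zero => exact ⟨0, zero_mem _, by simpa using hh⟩
    | succ N ih =>
      obtain ⟨h', hh', hmem⟩ := ih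
      obtain ⟨e, he, i, hi, hei⟩ := Submodule.mem_sup.mp hmem
      obtain ⟨E, hE, rfl⟩ := exists_isHomogeneous_eval_eq hx he
      obtain ⟨E₀, hE₀, hsupp, g, hg, r, hr, hEq⟩ := exists_restrict hx S (insert j S) j
        (fun i hi => Finset.mem_insert.mp hi) hE
      have hc := hS _ E₀ hE₀ hsupp (by
        refine Ideal.mem_sup_right ?_
        have h1 : eval x E₀ = x j * (h - h' - g) - i - r := by
          linear_combination hei - hEq
        rw [h1]
        exact sub_mem (sub_mem (Ideal.mul_mem_right _ _ hjJ) (span_image_compl_le S j hi))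
          (span_image_compl_le S j hr))
      refine ⟨h' + g, add_mem hh' (Ideal.pow_le_pow_right (by omega) hg), ?_⟩
      have h2 : x j * (h - (h' + g)) = eval x E₀ + (r + i) := by
        linear_combination hEq - hei
      rw [h2]
      exact add_mem (Ideal.mem_sup_left (eval_mem_pow_succ hx hE₀ hc))
        (Ideal.mem_sup_right (add_mem hr hi))
  have hcl : x j * h ∈ Ideal.span {x j} * maximalIdeal R ^ t ⊔ I := by
    refine Ideal.mem_of_forall_mem_sup_pow_maximalIdeal fun N => ?_
    obtain ⟨h', hh', hmem⟩ := key N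
    obtain ⟨e, he, i, hi, hei⟩ := Submodule.mem_sup.mp hmem
    have h1 : x j * h = x j * h' + i + e := by linear_combination -hei
    rw [h1]
    exact add_mem (Ideal.mem_sup_left (add_mem
      (Ideal.mem_sup_left (Ideal.mul_mem_mul (Ideal.mem_span_singleton_self _) hh'))
      (Ideal.mem_sup_right hi))) (Ideal.mem_sup_right (Ideal.pow_le_pow_right (by omega) he))
  obtain ⟨u, hu, i, hi, hui⟩ := Submodule.mem_sup.mp hcl
  obtain ⟨h', hh', rfl⟩ := Ideal.mem_span_singleton_mul.mp hu
  have h1 : x j * (h - h') ∈ I := by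
    have : x j * (h - h') = i := by linear_combination -hui
    rwa [this]
  rw [← add_sub_cancel h' h]
  exact add_mem (Ideal.mem_sup_left hh') (Ideal.mem_sup_right ((hp.mem_or_mem h1).resolve_left hj))

/-- Write `F = X j * G + F₀` with `F₀` free of `X j`. Modulo `x j` only `F₀` survives, so `hS`
controls its coefficients; then `x j` is cancelled from the rest and `G`, of smaller degree, is
handled by induction. -/
theorem quasiRegularOn_insert [IsNoetherianRing R] [DecidableEq ι]
    (hx : Ideal.span (Set.range x) = maximalIdeal R)
    {S : Finset ι} {j : ι} (hjS : j ∉ S) (hS : QuasiRegularOn x S)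
    (hp : (Ideal.span (x '' ((insert j S : Finset ι) : Set ι)ᶜ)).IsPrime)
    (hj : x j ∉ Ideal.span (x '' ((insert j S : Finset ι) : Set ι)ᶜ)) :
    QuasiRegularOn x (insert j S) := by
  intro s
  induction s with
  | zero =>
    intro F hF _ hev a
    have h0 : ∀ a ∈ F.support, a = 0 := fun a ha => by
      simpa [Finsupp.degree_eq_zero_iff] using hF.degree_eq_of_mem_support ha
    refine hS 0 F hF (fun a ha i _ => by rw [h0 a ha]; rfl) ?_ a
    exact sup_le_sup_left (span_image_compl_le S j) (maximalIdeal R ^ (0 + 1)) hev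
  | succ s ih =>
    intro F hF hsupp hev a
    set G := F.divMonomial (Finsupp.single j 1)
    set F₀ := F.modMonomial (Finsupp.single j 1)
    have hFG : X j * G + F₀ = F := divMonomial_add_modMonomial_single F j
    have hcF₀ : ∀ a, coeff a F₀ ≠ 0 → a j = 0 ∧ coeff a F₀ = coeff a F := by
      intro a ha
      by_cases hle : Finsupp.single j 1 ≤ a
      · exact absurd (coeff_modMonomial_of_le F hle) ha
      · refine ⟨?_, coeff_modMonomial_of_not_le F hle⟩
        rw [Finsupp.single_le_iff] at hle; omega
    have hF₀ : F₀.IsHomogeneous (s + 1) := fun a ha => hF (by rwa [← (hcF₀ a ha).2])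
    have hGh : G.IsHomogeneous s := by
      refine isHomogeneous_of_degree_eq fun a ha => ?_
      have h1 : coeff (Finsupp.single j 1 + a) F ≠ 0 := ha
      have := hF.degree_eq_of_mem_support (mem_support_iff.mpr h1)
      rw [map_add, Finsupp.degree_single] at this
      omega
    have hev' : x j * eval x G + eval x F₀ = eval x F := by
      rw [← hFG]; simp
    have hc₀ : ∀ a, coeff a F₀ ∈ maximalIdeal R := by
      refine hS (s + 1) F₀ hF₀ ?_ ?_
      · intro a ha i hi
        obtain ⟨h1, h2⟩ := hcF₀ a (mem_support_iff.mp ha)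
        by_cases hij : i = j
        · rw [hij, h1]
        · refine hsupp a (mem_support_iff.mpr ?_) i (by simp [hij, hi])
          rw [← h2]; exact mem_support_iff.mp ha
      · have h1 : eval x F₀ = eval x F - x j * eval x G := by linear_combination hev'
        rw [h1]
        refine sub_mem (sup_le_sup_left (span_image_compl_le S j) (maximalIdeal R ^ (s + 1 + 1)) hev) (Ideal.mem_sup_right ?_)
        exact Ideal.mul_mem_right _ _ (Ideal.subset_span ⟨j, by simpa using hjS, rfl⟩)
    have hGmem : eval x G ∈ maximalIdeal R ^ (s + 1) ⊔
        Ideal.span (x '' ((insert j S : Finset ι) : Set ι)ᶜ) := by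
      refine mem_pow_sup_of_mul_mem hx hjS hS hp hj ?_
      have h1 : x j * eval x G = eval x F - eval x F₀ := by linear_combination hev'
      rw [h1]
      exact sub_mem hev (Ideal.mem_sup_left (eval_mem_pow_succ hx hF₀ hc₀))
    have hcG := ih G hGh (by
      intro a ha i hi
      have h1 : coeff a G ≠ 0 := mem_support_iff.mp ha
      rw [coeff_divMonomial] at h1
      have := hsupp _ (mem_support_iff.mpr h1) i hi
      simp at this; exact this.2) hGmem
    by_cases hle : Finsupp.single j 1 ≤ a
    · have : coeff a F = coeff (a - Finsupp.single j 1) G := by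
        rw [coeff_divMonomial, add_tsub_cancel_of_le hle]
      rw [this]; exact hcG _
    · rw [← coeff_modMonomial_of_not_le F hle]; exact hc₀ a

/-- A minimal system of generators of the maximal ideal of a regular local ring is
quasi-regular. -/
theorem coeff_mem_maximalIdeal_of_eval_mem_pow_succ [IsNoetherianRing R]
    (hx : Ideal.span (Set.range x) = maximalIdeal R)
    (hdim : (Fintype.card ι : WithBot ℕ∞) ≤ ringKrullDim R) {s : ℕ} {F : MvPolynomial ι R}
    (hF : F.IsHomogeneous s) (hev : eval x F ∈ maximalIdeal R ^ (s + 1)) (a : ι →₀ ℕ) :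
    coeff a F ∈ maximalIdeal R := by
  classical
  have key : ∀ S : Finset ι, QuasiRegularOn x S := by
    intro S
    induction S using Finset.induction_on with
    | empty => exact quasiRegularOn_empty hx
    | insert j S hj ih =>
      refine quasiRegularOn_insert hx hj ih ?_ ?_
      · rw [← Finset.coe_compl]; exact isPrime_span_image_parameters hx hdim _
      · rw [← Finset.coe_compl]
        exact parameter_notMem_span_image hx hdim (by simp)
  exact key Finset.univ s F hF (by simp) (Ideal.mem_sup_left hev) a

end

end

/-! ### Weight filtrations and monomial valuations -/

section

open IsLocalRing MvPolynomial

section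

variable {R ι : Type*} [CommRing R] [Fintype ι] {x : ι → R}

/-- The ideal generated by the monomials of `w`-weight at least `s`. -/
def weightIdeal (x : ι → R) (w : ι → ℕ) (s : ℕ) : Ideal R :=
  Ideal.span (monomialValue x '' {a | s ≤ Finsupp.weight w a})

variable {w : ι → ℕ}

theorem monomialValue_mem_weightIdeal {a : ι →₀ ℕ} {s : ℕ} (h : s ≤ Finsupp.weight w a) :
    monomialValue x a ∈ weightIdeal x w s := Ideal.subset_span ⟨a, h, rfl⟩

theorem weightIdeal_anti {s t : ℕ} (h : s ≤ t) : weightIdeal x w t ≤ weightIdeal x w s :=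
  Ideal.span_mono (Set.image_mono fun _ ha => h.trans ha)

theorem weightIdeal_zero : weightIdeal x w 0 = ⊤ := by
  rw [Ideal.eq_top_iff_one, ← monomialValue_zero (x := x)]
  exact monomialValue_mem_weightIdeal (Nat.zero_le _)

theorem mul_mem_weightIdeal {s t : ℕ} {f g : R} (hf : f ∈ weightIdeal x w s)
    (hg : g ∈ weightIdeal x w t) : f * g ∈ weightIdeal x w (s + t) := by
  have h := Ideal.mul_mem_mul hf hg
  rw [weightIdeal, weightIdeal, Ideal.span_mul_span'] at h
  refine Ideal.span_mono ?_ h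
  rintro _ ⟨_, ⟨a, ha, rfl⟩, _, ⟨b, hb, rfl⟩, rfl⟩
  refine ⟨a + b, ?_, monomialValue_add a b⟩
  rw [Set.mem_ofPred_eq, map_add]
  exact add_le_add ha hb

theorem eval_mem_weightIdeal {P : MvPolynomial ι R} {s : ℕ}
    (hP : ∀ a ∈ P.support, s ≤ Finsupp.weight w a) : eval x P ∈ weightIdeal x w s :=
  eval_mem_span_monomialValue hP

/-- Supplies an initial form of `f`. It is not unique as a polynomial over `R`. -/
theorem exists_isWeightedHomogeneous_sub_mem {s : ℕ} {f : R} (hf : f ∈ weightIdeal x w s) :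
    ∃ P : MvPolynomial ι R, P.IsWeightedHomogeneous w s ∧
      f - eval x P ∈ weightIdeal x w (s + 1) := by
  classical
  obtain ⟨P, hP, rfl⟩ := exists_eval_eq_of_mem_span_monomialValue hf
  refine ⟨weightedHomogeneousComponent w s P, weightedHomogeneousComponent_isWeightedHomogeneous s P,
    ?_⟩
  rw [← map_sub]
  refine eval_mem_weightIdeal fun a ha => ?_
  have hne := mem_support_iff.mp ha
  rw [coeff_sub, coeff_weightedHomogeneousComponent] at hne
  split_ifs at hne with h
  · simp at hne
  · rw [sub_zero] at hne
    have : s ≤ Finsupp.weight w a := hP a (mem_support_iff.mpr hne)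
    omega

open scoped WithZero

/-- The value `exp (-s)`. -/
noncomputable def expNeg (s : ℕ) : ℤᵐ⁰ := WithZero.exp (-(s : ℤ))

theorem expNeg_ne_zero (s : ℕ) : expNeg s ≠ 0 := WithZero.exp_ne_zero

theorem expNeg_zero : expNeg 0 = 1 := by simp [expNeg]

theorem expNeg_add (s t : ℕ) : expNeg (s + t) = expNeg s * expNeg t := by
  rw [expNeg, Nat.cast_add, neg_add]; rfl

theorem expNeg_le_iff {s t : ℕ} : expNeg s ≤ expNeg t ↔ t ≤ s := by
  simp only [expNeg, WithZero.exp_le_exp, neg_le_neg_iff, Nat.cast_le]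

theorem expNeg_lt_iff {s t : ℕ} : expNeg s < expNeg t ↔ t < s := by
  simp only [expNeg, WithZero.exp_lt_exp, neg_lt_neg_iff, Nat.cast_lt]

theorem expNeg_injective : Function.Injective expNeg := fun _ _ h =>
  le_antisymm (expNeg_le_iff.mp h.ge) (expNeg_le_iff.mp h.le)

open Classical in
/-- The monomial valuation of weight `w`, as a function. -/
noncomputable def monomialValuationFun (x : ι → R) (w : ι → ℕ) (f : R) : ℤᵐ⁰ :=
  if h : ∃ s, f ∈ weightIdeal x w s ∧ f ∉ weightIdeal x w (s + 1) then expNeg h.choose else 0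

theorem monomialValuationFun_eq {f : R} {s : ℕ} (h : f ∈ weightIdeal x w s)
    (h' : f ∉ weightIdeal x w (s + 1)) : monomialValuationFun x w f = expNeg s := by
  have hex : ∃ s, f ∈ weightIdeal x w s ∧ f ∉ weightIdeal x w (s + 1) := ⟨s, h, h'⟩
  rw [monomialValuationFun, dif_pos hex]
  obtain ⟨h1, h2⟩ := hex.choose_spec
  congr 1
  by_contra hne
  rcases Nat.lt_or_gt_of_ne hne with hlt | hlt
  · exact h2 (weightIdeal_anti hlt h)
  · exact h' (weightIdeal_anti hlt h1)

theorem monomialValuationFun_zero : monomialValuationFun x w 0 = 0 := by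
  rw [monomialValuationFun, dif_neg]
  rintro ⟨s, -, h⟩
  exact h (zero_mem _)

end

section

variable {R ι : Type*} [CommRing R] [IsLocalRing R] [Fintype ι] {x : ι → R}

/-- An element of a monomial ideal is the value of a polynomial whose exponents lie in the ideal and
whose coefficients in degrees below `N` are units. -/
theorem exists_eval_eq_isUnit_coeff (hx : Ideal.span (Set.range x) = maximalIdeal R)
    {B : Set (ι →₀ ℕ)} (hB : ∀ a ∈ B, ∀ i, a + Finsupp.single i 1 ∈ B) {z : R}
    (hz : z ∈ Ideal.span (monomialValue x '' B)) (N : ℕ) :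
    ∃ P : MvPolynomial ι R, (∀ a ∈ P.support, a ∈ B) ∧ eval x P = z ∧
      ∀ a ∈ P.support, a.degree < N → IsUnit (coeff a P) := by
  classical
  induction N with
  | zero =>
    obtain ⟨P, hP, h⟩ := exists_eval_eq_of_mem_span_monomialValue hz
    exact ⟨P, hP, h, by simp⟩
  | succ N ih =>
    obtain ⟨P, hP, hPz, hu⟩ := ih
    set bad : (ι →₀ ℕ) → Prop := fun a => a.degree = N ∧ ¬ IsUnit (coeff a P)
    set P₁ : MvPolynomial ι R := ∑ a ∈ P.support with ¬ bad a, monomial a (coeff a P)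
    have hc₁ : ∀ a, coeff a P₁ = if a ∈ P.support ∧ ¬ bad a then coeff a P else 0 := by
      intro a
      simp only [P₁, coeff_sum, coeff_monomial, Finset.sum_ite_eq', Finset.mem_filter]
    -- A nonunit coefficient is a combination of the parameters, so its term can be rewritten with
    -- exponents one degree higher.
    have hrest : (∑ a ∈ P.support with bad a, coeff a P * monomialValue x a) ∈
        Ideal.span (monomialValue x '' (B ∩ {a | N + 1 ≤ a.degree})) := by
      refine Ideal.sum_mem _ fun a ha => ?_
      obtain ⟨haP, hdeg, hnu⟩ := Finset.mem_filter.mp ha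
      have h1 : coeff a P * monomialValue x a ∈
          Ideal.span (Set.range x) * Ideal.span {monomialValue x a} :=
        Ideal.mul_mem_mul (by rw [hx]; exact hnu) (Ideal.mem_span_singleton_self _)
      rw [Ideal.span_mul_span'] at h1
      refine Ideal.span_mono ?_ h1
      rintro _ ⟨_, ⟨i, rfl⟩, _, rfl, rfl⟩
      refine ⟨a + Finsupp.single i 1, ⟨hB a (hP a haP) i, ?_⟩, ?_⟩
      · simp [hdeg]
      · rw [monomialValue_add, monomialValue_single, mul_comm]
    obtain ⟨Q, hQ, hQe⟩ := exists_eval_eq_of_mem_span_monomialValue hrest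
    refine ⟨P₁ + Q, ?_, ?_, ?_⟩
    · intro a ha
      rcases Finset.mem_union.mp (support_add ha) with h | h
      · refine hP a ?_
        by_contra hn
        exact mem_support_iff.mp h (by rw [hc₁, if_neg (fun h => hn h.1)])
      · exact (hQ a h).1
    · rw [map_add, hQe, ← hPz, eval_eq_sum_monomialValue P,
        ← Finset.sum_filter_add_sum_filter_not P.support bad, map_sum, add_comm]
      exact congrArg _ (Finset.sum_congr rfl fun a _ => eval_monomial_eq a _)
    · intro a ha hdeg
      have hQ0 : coeff a Q = 0 := by
        by_contra hn
        have : N + 1 ≤ a.degree := (hQ a (mem_support_iff.mpr hn)).2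
        omega
      have hne := mem_support_iff.mp ha
      rw [coeff_add, hQ0, add_zero, hc₁] at hne ⊢
      split_ifs at hne ⊢ with h
      · obtain ⟨haP, hb⟩ := h
        by_cases hN : a.degree = N
        · by_contra hnu; exact hb ⟨hN, hnu⟩
        · exact hu a haP (by omega)
      · exact absurd rfl hne

variable {w : ι → ℕ}

theorem mem_weightIdeal_one (hx : Ideal.span (Set.range x) = maximalIdeal R) (hw : ∀ i, 0 < w i)
    {c : R} (hc : c ∈ maximalIdeal R) : c ∈ weightIdeal x w 1 := by
  rw [← hx] at hc
  refine Ideal.span_le.mpr ?_ hc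
  rintro _ ⟨i, rfl⟩
  rw [← monomialValue_single (x := x)]
  exact monomialValue_mem_weightIdeal (by
    simpa [Finsupp.weight_apply] using Nat.succ_le_of_lt (hw i))

theorem eval_mem_weightIdeal_succ (hx : Ideal.span (Set.range x) = maximalIdeal R)
    (hw : ∀ i, 0 < w i) {P : MvPolynomial ι R} {s : ℕ}
    (hP : ∀ a ∈ P.support, s ≤ Finsupp.weight w a) (hc : ∀ a, coeff a P ∈ maximalIdeal R) :
    eval x P ∈ weightIdeal x w (s + 1) := by
  rw [eval_eq_sum_monomialValue]
  refine Ideal.sum_mem _ fun a ha => ?_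
  rw [add_comm]
  exact mul_mem_weightIdeal (mem_weightIdeal_one hx hw (hc a))
    (monomialValue_mem_weightIdeal (hP a ha))

/-- Any common bound for the weights would serve as the constant; the `+ 1` makes it positive even
for zero weights. -/
theorem weightIdeal_le_pow (hx : Ideal.span (Set.range x) = maximalIdeal R) (t : ℕ) :
    weightIdeal x w ((∑ i, w i + 1) * t) ≤ maximalIdeal R ^ t := by
  rw [weightIdeal, Ideal.span_le]
  rintro _ ⟨a, ha, rfl⟩
  have ha' : (∑ i, w i + 1) * t ≤ Finsupp.weight w a := ha
  refine Ideal.pow_le_pow_right ?_ (monomialValue_mem_pow hx a)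
  have h1 : Finsupp.weight w a ≤ a.degree * (∑ i, w i + 1) := by
    rw [Finsupp.weight_apply, Finsupp.sum_fintype _ _ (by simp), Finsupp.degree_eq_sum,
      Finset.sum_mul]
    refine Finset.sum_le_sum fun i _ => ?_
    rw [smul_eq_mul]
    refine Nat.mul_le_mul_left _ ?_
    have := Finset.single_le_sum (f := w) (fun i _ => Nat.zero_le _) (Finset.mem_univ i)
    omega
  have h2 : t * (∑ i, w i + 1) ≤ a.degree * (∑ i, w i + 1) := by
    rw [mul_comm t]; exact ha'.trans h1
  exact Nat.le_of_mul_le_mul_right h2 (Nat.succ_pos _)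

variable [IsNoetherianRing R]

/-- Weighted quasi-regularity, reduced to the ordinary one. A unit coefficient would yield a
relation `P₁ - Q` vanishing at `x`, where `P₁` has weight `s` and `Q` has larger weights. The
weights separate the supports, so nothing cancels, and the form of lowest degree of the relation
contradicts ordinary quasi-regularity. -/
theorem coeff_mem_of_eval_mem_weightIdeal_succ (hx : Ideal.span (Set.range x) = maximalIdeal R)
    (hdim : (Fintype.card ι : WithBot ℕ∞) ≤ ringKrullDim R) (hw : ∀ i, 0 < w i)
    {P : MvPolynomial ι R} {s : ℕ} (hP : P.IsWeightedHomogeneous w s)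
    (hev : eval x P ∈ weightIdeal x w (s + 1)) (b : ι →₀ ℕ) : coeff b P ∈ maximalIdeal R := by
  classical
  by_contra hb
  have hbu : IsUnit (coeff b P) := by simpa using hb
  set p : (ι →₀ ℕ) → Prop := fun a => IsUnit (coeff a P)
  set P₁ : MvPolynomial ι R := ∑ a ∈ P.support with p a, monomial a (coeff a P)
  have hc₁ : ∀ a, coeff a P₁ = if a ∈ P.support ∧ p a then coeff a P else 0 := by
    intro a
    simp only [P₁, coeff_sum, coeff_monomial, Finset.sum_ite_eq', Finset.mem_filter]
  have hbP : b ∈ P.support := mem_support_iff.mpr hbu.ne_zero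
  have hb₁ : coeff b P₁ = coeff b P := by rw [hc₁, if_pos ⟨hbP, hbu⟩]
  have hP₁ : ∀ a, coeff a P₁ ≠ 0 → IsUnit (coeff a P₁) ∧ Finsupp.weight w a = s := by
    intro a ha
    rw [hc₁] at ha ⊢
    split_ifs at ha ⊢ with h
    · exact ⟨h.2, hP ha⟩
    · exact absurd rfl ha
  have hev₁ : eval x P₁ ∈ weightIdeal x w (s + 1) := by
    have h1 : eval x P = eval x P₁ + ∑ a ∈ P.support with ¬ p a, coeff a P * monomialValue x a := by
      rw [map_sum, eval_eq_sum_monomialValue P, ← Finset.sum_filter_add_sum_filter_not _ p]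
      congr 1
      exact Finset.sum_congr rfl fun a _ => (eval_monomial_eq a _).symm
    rw [← add_sub_cancel_right (eval x P₁), ← h1]
    refine sub_mem hev (Ideal.sum_mem _ fun a ha => ?_)
    obtain ⟨haP, hpa⟩ := Finset.mem_filter.mp ha
    rw [add_comm s]
    exact mul_mem_weightIdeal (mem_weightIdeal_one hx hw hpa)
      (monomialValue_mem_weightIdeal (hP (mem_support_iff.mp haP)).ge)
  -- Unit coefficients are needed up to the degree of `b`, since `b` survives in the relation and
  -- bounds its lowest degree.
  obtain ⟨Q, hQ, hQe, hQu⟩ := exists_eval_eq_isUnit_coeff hx (B := {a | s + 1 ≤ Finsupp.weight w a})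
    (fun a (ha : s + 1 ≤ Finsupp.weight w a) i => by
      rw [Set.mem_ofPred_eq, map_add]; omega) hev₁ (b.degree + 1)
  have hdisj : ∀ a, coeff a P₁ = 0 ∨ coeff a Q = 0 := by
    intro a
    by_contra! h
    have h1 := (hP₁ a h.1).2
    have h2 : s + 1 ≤ Finsupp.weight w a := hQ a (mem_support_iff.mpr h.2)
    omega
  set D := P₁ - Q
  have hDe : eval x D = 0 := by simp [D, hQe]
  have hDu : ∀ a ∈ D.support, a.degree < b.degree + 1 → IsUnit (coeff a D) := by
    intro a ha hlt
    have hne := mem_support_iff.mp ha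
    rw [coeff_sub] at hne ⊢
    rcases hdisj a with h | h
    · rw [h, zero_sub] at hne ⊢
      exact (hQu a (mem_support_iff.mpr (neg_ne_zero.mp hne)) hlt).neg
    · rw [h, sub_zero] at hne ⊢
      exact (hP₁ a hne).1
  have hbD : b ∈ D.support := by
    rw [mem_support_iff, coeff_sub, (hdisj b).resolve_left (by rw [hb₁]; exact hbu.ne_zero),
      sub_zero, hb₁]
    exact hbu.ne_zero
  obtain ⟨a, haD, hmin⟩ := D.support.exists_min_image Finsupp.degree ⟨b, hbD⟩
  have hhom : eval x (homogeneousComponent a.degree D) ∈ maximalIdeal R ^ (a.degree + 1) := by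
    have h1 : eval x (homogeneousComponent a.degree D) =
        -eval x (D - homogeneousComponent a.degree D) := by
      rw [map_sub (eval x) D, hDe, zero_sub, neg_neg]
    rw [h1]
    refine neg_mem ?_
    rw [eval_eq_sum_monomialValue]
    refine Ideal.sum_mem _ fun c hc => Ideal.mul_mem_left _ _
      (Ideal.pow_le_pow_right ?_ (monomialValue_mem_pow hx c))
    have hne := mem_support_iff.mp hc
    rw [coeff_sub, coeff_homogeneousComponent] at hne
    split_ifs at hne with h
    · simp at hne
    · rw [sub_zero] at hne
      have := hmin c (mem_support_iff.mpr hne)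
      omega
  have hm := coeff_mem_maximalIdeal_of_eval_mem_pow_succ hx hdim
    (homogeneousComponent_isHomogeneous a.degree D) hhom a
  rw [coeff_homogeneousComponent, if_pos rfl] at hm
  exact (mem_maximalIdeal _).mp hm (hDu a haD (Nat.lt_succ_of_le (hmin b hbD)))

theorem monomialValue_notMem_weightIdeal (hx : Ideal.span (Set.range x) = maximalIdeal R)
    (hdim : (Fintype.card ι : WithBot ℕ∞) ≤ ringKrullDim R) (hw : ∀ i, 0 < w i) (a : ι →₀ ℕ) :
    monomialValue x a ∉ weightIdeal x w (Finsupp.weight w a + 1) := by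
  classical
  intro h
  have := coeff_mem_of_eval_mem_weightIdeal_succ hx hdim hw
    (isWeightedHomogeneous_monomial w a (1 : R) rfl) (by rwa [eval_monomial_eq, one_mul]) a
  rw [coeff_monomial, if_pos rfl] at this
  exact (mem_maximalIdeal _).mp this isUnit_one

/-- The initial forms are nonzero over the residue field, and polynomials over a field form a
domain. This is multiplicativity of the valuation. -/
theorem mul_notMem_weightIdeal (hx : Ideal.span (Set.range x) = maximalIdeal R)
    (hdim : (Fintype.card ι : WithBot ℕ∞) ≤ ringKrullDim R) (hw : ∀ i, 0 < w i) {s t : ℕ} {f g : R}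
    (hf : f ∈ weightIdeal x w s) (hf' : f ∉ weightIdeal x w (s + 1))
    (hg : g ∈ weightIdeal x w t) (hg' : g ∉ weightIdeal x w (t + 1)) :
    f * g ∉ weightIdeal x w (s + t + 1) := by
  intro hfg
  obtain ⟨P, hP, hPf⟩ := exists_isWeightedHomogeneous_sub_mem hf
  obtain ⟨Q, hQ, hQg⟩ := exists_isWeightedHomogeneous_sub_mem hg
  have hPQ : eval x (P * Q) ∈ weightIdeal x w (s + t + 1) := by
    have h1 : eval x (P * Q) = f * g - f * (g - eval x Q) - (f - eval x P) * eval x Q := by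
      rw [map_mul]; ring
    rw [h1]
    refine sub_mem (sub_mem hfg (by rw [add_assoc]; exact mul_mem_weightIdeal hf hQg)) ?_
    rw [add_right_comm]
    refine mul_mem_weightIdeal hPf ?_
    exact eval_mem_weightIdeal fun a ha => (hQ (mem_support_iff.mp ha)).ge
  have hc := coeff_mem_of_eval_mem_weightIdeal_succ hx hdim hw (hP.mul hQ) hPQ
  have h0 : map (residue R) P * map (residue R) Q = 0 := by
    rw [← map_mul]
    ext a
    rw [coeff_map, coeff_zero, residue_eq_zero_iff]
    exact hc a
  have aux : ∀ {u : ℕ} {h : R} {H : MvPolynomial ι R}, H.IsWeightedHomogeneous w u →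
      h - eval x H ∈ weightIdeal x w (u + 1) → map (residue R) H = 0 →
      h ∈ weightIdeal x w (u + 1) := by
    intro u h H hH hh hz
    rw [← sub_add_cancel h (eval x H)]
    refine add_mem hh (eval_mem_weightIdeal_succ hx hw
      (fun a ha => (hH (mem_support_iff.mp ha)).ge) fun a => ?_)
    rw [← residue_eq_zero_iff, ← coeff_map, hz, coeff_zero]
  rcases mul_eq_zero.mp h0 with h | h
  · exact hf' (aux hP hPf h)
  · exact hg' (aux hQ hQg h)

theorem exists_notMem_weightIdeal (hx : Ideal.span (Set.range x) = maximalIdeal R) {f : R}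
    (hf : f ≠ 0) : ∃ s, f ∈ weightIdeal x w s ∧ f ∉ weightIdeal x w (s + 1) := by
  classical
  have hex : ∃ s, f ∉ weightIdeal x w s := by
    by_contra! h
    refine hf ?_
    rw [← Ideal.mem_bot, ← Ideal.iInf_pow_eq_bot_of_isLocalRing (maximalIdeal R)
      (maximalIdeal.isMaximal R).ne_top, Ideal.mem_iInf]
    exact fun t => weightIdeal_le_pow hx t (h _)
  have h0 : Nat.find hex ≠ 0 := by
    intro h
    have := Nat.find_spec hex
    rw [h, weightIdeal_zero] at this
    exact this trivial
  obtain ⟨s, hs⟩ := Nat.exists_eq_succ_of_ne_zero h0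
  refine ⟨s, ?_, ?_⟩
  · by_contra h
    exact Nat.find_min hex (m := s) (by omega) h
  · have := Nat.find_spec hex
    rwa [hs] at this

end

section

open scoped WithZero

variable {R ι : Type*} [CommRing R] [IsLocalRing R] [IsNoetherianRing R] [Fintype ι]
  {x : ι → R} {w : ι → ℕ}

theorem monomialValuationFun_le_iff (hx : Ideal.span (Set.range x) = maximalIdeal R) {f : R}
    {s : ℕ} : monomialValuationFun x w f ≤ expNeg s ↔ f ∈ weightIdeal x w s := by
  by_cases hf : f = 0
  · simp [hf, monomialValuationFun_zero]
  obtain ⟨t, h, h'⟩ := exists_notMem_weightIdeal (w := w) hx hf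
  rw [monomialValuationFun_eq h h', expNeg_le_iff]
  refine ⟨fun hst => weightIdeal_anti hst h, fun hfs => ?_⟩
  by_contra hlt
  exact h' (weightIdeal_anti (by omega) hfs)

/-- The valuation sending the monomial with exponent `a` in the regular parameters `x` to
`exp (-w · a)`. -/
noncomputable def monomialValuation (hx : Ideal.span (Set.range x) = maximalIdeal R)
    (hdim : (Fintype.card ι : WithBot ℕ∞) ≤ ringKrullDim R) (hw : ∀ i, 0 < w i) :
    Valuation R ℤᵐ⁰ where
  toFun := monomialValuationFun x w
  map_zero' := monomialValuationFun_zero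
  map_one' := by
    rw [← expNeg_zero]
    refine monomialValuationFun_eq (by rw [weightIdeal_zero]; trivial) ?_
    have := monomialValue_notMem_weightIdeal hx hdim hw (0 : ι →₀ ℕ)
    rwa [monomialValue_zero, map_zero] at this
  map_mul' f g := by
    by_cases hf : f = 0
    · simp [hf, monomialValuationFun_zero]
    by_cases hg : g = 0
    · simp [hg, monomialValuationFun_zero]
    obtain ⟨s, h1, h2⟩ := exists_notMem_weightIdeal (w := w) hx hf
    obtain ⟨t, h3, h4⟩ := exists_notMem_weightIdeal (w := w) hx hg
    rw [monomialValuationFun_eq h1 h2, monomialValuationFun_eq h3 h4, ← expNeg_add]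
    exact monomialValuationFun_eq (mul_mem_weightIdeal h1 h3)
      (mul_notMem_weightIdeal hx hdim hw h1 h2 h3 h4)
  map_add_le_max' f g := by
    by_cases hf : f = 0
    · simp [hf, monomialValuationFun_zero]
    by_cases hg : g = 0
    · simp [hg, monomialValuationFun_zero]
    obtain ⟨s, h1, h2⟩ := exists_notMem_weightIdeal (w := w) hx hf
    obtain ⟨t, h3, h4⟩ := exists_notMem_weightIdeal (w := w) hx hg
    change monomialValuationFun x w (f + g) ≤ _
    rw [monomialValuationFun_eq h1 h2, monomialValuationFun_eq h3 h4, le_max_iff,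
      monomialValuationFun_le_iff hx, monomialValuationFun_le_iff hx]
    rcases le_total s t with h | h
    · exact Or.inl (add_mem h1 (weightIdeal_anti h h3))
    · exact Or.inr (add_mem (weightIdeal_anti h h1) h3)

/-- There is a monomial valuation with any prescribed positive weights on the fraction field of a
regular local ring. -/
theorem exists_monomialValuation (K : Type*) [Field K] [Algebra R K] [IsFractionRing R K]
    (hx : Ideal.span (Set.range x) = maximalIdeal R)
    (hdim : (Fintype.card ι : WithBot ℕ∞) ≤ ringKrullDim R) (hw : ∀ i, 0 < w i) :
    ∃ V : Valuation K ℤᵐ⁰,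
      (∀ (f : R) (s : ℕ), V (algebraMap R K f) ≤ expNeg s ↔ f ∈ weightIdeal x w s) ∧
      (∀ i, V (algebraMap R K (x i)) = expNeg (w i)) ∧
      ∀ f : R, f ≠ 0 → ∃ s, V (algebraMap R K f) = expNeg s := by
  set v := monomialValuation hx hdim hw
  have hv : ∀ f, v f = monomialValuationFun x w f := fun _ => rfl
  have hex : ∀ f : R, f ≠ 0 → ∃ s, v f = expNeg s := fun f hf => by
    obtain ⟨s, h1, h2⟩ := exists_notMem_weightIdeal (w := w) hx hf
    exact ⟨s, monomialValuationFun_eq h1 h2⟩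
  -- The valuation vanishes only at `0`, so it extends to fractions.
  have hS : nonZeroDivisors R ≤ v.supp.primeCompl := by
    intro f hf hmem
    obtain ⟨s, hs⟩ := hex f (nonZeroDivisors.ne_zero hf)
    exact expNeg_ne_zero s (hs ▸ (Valuation.mem_supp_iff v f).mp hmem)
  refine ⟨v.extendToLocalization hS K, fun f s => ?_, fun i => ?_, fun f hf => ?_⟩
  · rw [Valuation.extendToLocalization_apply_map_apply, hv, monomialValuationFun_le_iff hx]
  · rw [Valuation.extendToLocalization_apply_map_apply, hv]
    have h1 : Finsupp.weight w (Finsupp.single i 1) = w i := by simp [Finsupp.weight_apply]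
    rw [← monomialValue_single (x := x), ← h1]
    exact monomialValuationFun_eq (monomialValue_mem_weightIdeal le_rfl)
      (monomialValue_notMem_weightIdeal hx hdim hw _)
  · rw [Valuation.extendToLocalization_apply_map_apply]
    exact hex f hf

end

end

/-! ### Monomial transforms and valuations on them -/

section

open IsLocalRing

namespace MonomialLQT

open scoped WithZero

section

variable {R K ι : Type*} [CommRing R] [Field K] [Algebra R K]

/-- The elements `u` are nonzero and generate the maximal ideal of the local ring `A`. -/
structure IsParameters (A : Subalgebra R K) [IsLocalRing A] (u : ι → K) : Prop where
  mem : ∀ k, u k ∈ A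
  ne_zero : ∀ k, u k ≠ 0
  span_eq : Ideal.span {s : A | (s : K) ∈ Set.range u} = maximalIdeal A

variable {A B : Subalgebra R K} {u v : ι → K} {j : ι}

theorem le_chart : A ≤ chart A u j := fun _ hz => Algebra.subset_adjoin (Or.inl hz)

theorem div_mem_chart (k : ι) : u k / u j ∈ chart A u j :=
  Algebra.subset_adjoin (Or.inr ⟨k, rfl⟩)

theorem IsMonomialTransform.apply_self (h : IsMonomialTransform A u B v j) : v j = u j := by
  rw [h.1, if_pos rfl]

theorem IsMonomialTransform.apply_of_ne (h : IsMonomialTransform A u B v j) {k : ι} (hk : k ≠ j) :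
    v k = u k / u j := by
  rw [h.1, if_neg hk]

theorem IsMonomialTransform.mul_eq (h : IsMonomialTransform A u B v j) (hj : u j ≠ 0) {k : ι}
    (hk : k ≠ j) : u k = v k * v j := by
  rw [h.apply_of_ne hk, h.apply_self, div_mul_cancel₀ _ hj]

theorem IsMonomialTransform.mem_chart (h : IsMonomialTransform A u B v j) (hu : ∀ k, u k ∈ A)
    (k : ι) : v k ∈ chart A u j := by
  by_cases hk : k = j
  · subst hk; rw [h.apply_self]; exact le_chart (hu k)
  · rw [h.apply_of_ne hk]; exact div_mem_chart k

/-- The ideal generated by the new variables `v` in `A[u₁ / uⱼ, …, u_d / uⱼ]`. -/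
abbrev chartIdeal (A : Subalgebra R K) (u v : ι → K) (j : ι) : Ideal (chart A u j) :=
  Ideal.span {s : chart A u j | (s : K) ∈ Set.range v}

/-- Writing `0 ∈ B` as a fraction exhibits a denominator outside the ideal, which is therefore
proper. -/
theorem IsMonomialTransform.one_notMem (h : IsMonomialTransform A u B v j) :
    (1 : chart A u j) ∉ chartIdeal A u v j := by
  obtain ⟨a, b, hb, -⟩ := (h.2 0).mp (zero_mem B)
  exact fun h1 => hb (((Ideal.eq_top_iff_one (chartIdeal A u v j)).mpr h1).ge trivial)

theorem IsMonomialTransform.chart_le (h : IsMonomialTransform A u B v j) : chart A u j ≤ B :=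
  fun z hz => (h.2 z).mpr ⟨⟨z, hz⟩, 1, h.one_notMem, by simp⟩

theorem IsMonomialTransform.le (h : IsMonomialTransform A u B v j) : A ≤ B :=
  le_chart.trans h.chart_le

theorem IsMonomialTransform.inv_mem (h : IsMonomialTransform A u B v j) {b : chart A u j}
    (hb : b ∉ chartIdeal A u v j) : (b : K)⁻¹ ∈ B :=
  (h.2 _).mpr ⟨1, b, hb, by simp⟩

theorem coe_ne_zero_of_notMem {b : chart A u j} (hb : b ∉ chartIdeal A u v j) : (b : K) ≠ 0 := by
  intro h0
  exact hb ((Subtype.ext h0 : b = 0) ▸ zero_mem _)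

theorem IsMonomialTransform.map_chartIdeal_le (h : IsMonomialTransform A u B v j) :
    (chartIdeal A u v j).map (Subalgebra.inclusion h.chart_le) ≤
      Ideal.span {s : B | (s : K) ∈ Set.range v} := by
  rw [Ideal.map_span, Ideal.span_le]
  rintro _ ⟨s, hs, rfl⟩
  exact Ideal.subset_span hs

/-- An inverse `a / b` of `v k` would give `b = v k * a` in the chart ideal; conversely a fraction
whose numerator is outside that ideal is invertible. -/
theorem IsMonomialTransform.isParameters [IsLocalRing A] [IsLocalRing B]
    (h : IsMonomialTransform A u B v j) (hA : IsParameters A u) : IsParameters B v := by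
  have hv : ∀ k, v k ∈ B := fun k => h.chart_le (h.mem_chart hA.mem k)
  refine ⟨hv, fun k => ?_, le_antisymm ?_ ?_⟩
  · by_cases hk : k = j
    · subst hk; rw [h.apply_self]; exact hA.ne_zero k
    · rw [h.apply_of_ne hk]; exact div_ne_zero (hA.ne_zero k) (hA.ne_zero j)
  · rw [Ideal.span_le]
    rintro s ⟨k, hk⟩
    rw [SetLike.mem_coe, mem_maximalIdeal, mem_nonunits_iff, isUnit_iff_exists_inv]
    rintro ⟨z, hz⟩
    obtain ⟨a, b, hb, hab⟩ := (h.2 z).mp z.2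
    have hb0 := coe_ne_zero_of_notMem hb
    have h1 : v k * (a : K) = b := by
      have h2 : (s : K) * (z : K) = 1 := by exact_mod_cast congrArg Subtype.val hz
      rw [← hk, hab] at h2
      field_simp at h2
      exact h2
    apply hb
    have h2 : (⟨v k, h.mem_chart hA.mem k⟩ : chart A u j) * a = b := Subtype.ext h1
    rw [← h2]
    exact Ideal.mul_mem_right _ _ (Ideal.subset_span ⟨k, rfl⟩)
  · intro z hz
    obtain ⟨a, b, hb, hab⟩ := (h.2 z).mp z.2
    have hb0 := coe_ne_zero_of_notMem hb
    by_cases ha : a ∈ chartIdeal A u v j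
    · have h1 := h.map_chartIdeal_le (Ideal.mem_map_of_mem _ ha)
      have h2 : z = ⟨(b : K)⁻¹, h.inv_mem hb⟩ * Subalgebra.inclusion h.chart_le a := by
        apply Subtype.ext
        rw [hab, div_eq_mul_inv, mul_comm]; rfl
      rw [h2]
      exact Ideal.mul_mem_left _ _ h1
    · exfalso
      have ha0 := coe_ne_zero_of_notMem ha
      refine (mem_maximalIdeal _).mp hz (isUnit_iff_exists_inv.mpr
        ⟨⟨(b : K) / a, (h.2 _).mpr ⟨b, a, ha, rfl⟩⟩, Subtype.ext ?_⟩)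
      change (z : K) * (b / a) = 1
      rw [hab]; field_simp

/-- Each adjoined quotient is `1` or a new variable, so modulo the new variables the chart adds
nothing to `A`. -/
theorem IsMonomialTransform.exists_add (h : IsMonomialTransform A u B v j) (hj : u j ≠ 0) {c : K}
    (hc : c ∈ chart A u j) :
    ∃ a ∈ A, ∃ s ∈ chartIdeal A u v j, c = a + (s : K) := by
  induction hc using Algebra.adjoin_induction with
  | mem z hz =>
    rcases hz with hz | ⟨k, rfl⟩
    · exact ⟨z, hz, 0, zero_mem _, by simp⟩
    · by_cases hk : k = j
      · subst hk
        exact ⟨1, one_mem _, 0, zero_mem _, by simp [div_self hj]⟩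
      · refine ⟨0, zero_mem _, ⟨u k / u j, div_mem_chart k⟩, Ideal.subset_span ⟨k, ?_⟩, by simp⟩
        exact h.apply_of_ne hk
  | algebraMap r => exact ⟨algebraMap R K r, A.algebraMap_mem r, 0, zero_mem _, by simp⟩
  | add y z _ _ hy hz =>
    obtain ⟨a, ha, s, hs, rfl⟩ := hy
    obtain ⟨b, hb, t, ht, rfl⟩ := hz
    exact ⟨a + b, add_mem ha hb, s + t, add_mem hs ht, by push_cast; ring⟩
  | mul y z _ _ hy hz =>
    obtain ⟨a, ha, s, hs, rfl⟩ := hy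
    obtain ⟨b, hb, t, ht, rfl⟩ := hz
    refine ⟨a * b, mul_mem ha hb, ⟨a, le_chart ha⟩ * t + ⟨b, le_chart hb⟩ * s + s * t, ?_,
      by push_cast; ring⟩
    exact add_mem (add_mem (Ideal.mul_mem_left _ _ ht) (Ideal.mul_mem_left _ _ hs))
      (Ideal.mul_mem_left _ _ ht)

variable {Γ : Type*} [LinearOrderedCommGroupWithZero Γ]

/-- A valuation that is nonnegative on `A` and positive on the new variables is nonnegative on the
monomial transform of `A`. -/
theorem IsMonomialTransform.valuation_le_one [IsLocalRing A] (h : IsMonomialTransform A u B v j)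
    (hA : IsParameters A u) (V : Valuation K Γ) (hVA : ∀ z ∈ A, V z ≤ 1) (hVv : ∀ k, V (v k) < 1) :
    ∀ z ∈ B, V z ≤ 1 := by
  have hj := hA.ne_zero j
  have hC : ∀ c ∈ chart A u j, V c ≤ 1 := by
    intro c hc
    induction hc using Algebra.adjoin_induction with
    | mem z hz =>
      rcases hz with hz | ⟨k, rfl⟩
      · exact hVA z hz
      · by_cases hk : k = j
        · subst hk; simp [div_self hj]
        · change V (u k / u j) ≤ 1
          rw [← h.apply_of_ne hk]; exact (hVv k).le
    | algebraMap r => exact hVA _ (A.algebraMap_mem r)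
    | add y z _ _ hy hz => exact (V.map_add y z).trans (max_le hy hz)
    | mul y z _ _ hy hz => rw [map_mul]; exact mul_le_one' hy hz
  have hI : ∀ s ∈ chartIdeal A u v j, V (s : K) < 1 := by
    intro s hs
    induction hs using Submodule.span_induction with
    | mem s hs => obtain ⟨k, hk⟩ := hs; rw [← hk]; exact hVv k
    | zero => simp
    | add y z _ _ hy hz => exact V.map_add_lt hy hz
    | smul r z _ hz =>
      rw [smul_eq_mul, MulMemClass.coe_mul, map_mul]
      exact (mul_le_of_le_one_left' (hC r r.2)).trans_lt hz
  -- Each old variable is a multiple of a new one, by `u k = v k * v j` or `u j = v j`.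
  have hAI : ∀ c : A, c ∈ maximalIdeal A → Subalgebra.inclusion le_chart c ∈ chartIdeal A u v j := by
    intro c hc
    rw [← hA.span_eq] at hc
    have h1 := Ideal.mem_map_of_mem (Subalgebra.inclusion (le_chart (A := A) (u := u) (j := j))) hc
    refine (Ideal.map_le_iff_le_comap.mpr (Ideal.span_le.mpr ?_)) h1
    rintro s ⟨k, hk⟩
    by_cases hkj : k = j
    · refine Ideal.subset_span ⟨j, ?_⟩
      rw [h.apply_self, ← hkj, hk]; rfl
    · have h2 : Subalgebra.inclusion (le_chart (A := A) (u := u) (j := j)) s =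
          ⟨v k, h.mem_chart hA.mem k⟩ * ⟨v j, h.mem_chart hA.mem j⟩ := by
        apply Subtype.ext
        change (s : K) = v k * v j
        rw [← hk, h.mul_eq hj hkj]
      rw [SetLike.mem_coe, Ideal.mem_comap, h2]
      exact Ideal.mul_mem_right _ _ (Ideal.subset_span ⟨k, rfl⟩)
  intro z hz
  obtain ⟨a, b, hb, rfl⟩ := (h.2 z).mp hz
  obtain ⟨c, hc, s, hs, hcs⟩ := h.exists_add hj b.2
  -- The denominator is thus a unit of `A` plus an element of positive value, so it has value `1` in
  -- the multiplicative notation.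
  have hcu : IsUnit (⟨c, hc⟩ : A) := by
    by_contra hn
    have h1 := hAI ⟨c, hc⟩ hn
    have h2 : b = Subalgebra.inclusion le_chart ⟨c, hc⟩ + s := Subtype.ext hcs
    exact hb (h2 ▸ add_mem h1 hs)
  have hVc : V c = 1 := by
    obtain ⟨e, he⟩ := isUnit_iff_exists_inv.mp hcu
    have h1 : c * (e : K) = 1 := congrArg Subtype.val he
    refine le_antisymm (hVA c hc) ?_
    rw [← V.map_one, ← h1, map_mul]
    exact mul_le_of_le_one_right' (hVA e e.2)
  have hVb : V (b : K) = 1 := by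
    rw [hcs, V.map_add_eq_of_lt_left (by rw [hVc]; exact hI s hs), hVc]
  rw [map_div₀, hVb, div_one]
  exact hC a a.2

/-- A valuation centered on the maximal ideal bounds the order. -/
theorem valuation_le_expNeg_of_mem_pow [IsLocalRing A] (hA : IsParameters A u)
    (V : Valuation K ℤᵐ⁰) (hVA : ∀ z ∈ A, V z ≤ 1) (hVu : ∀ k, V (u k) ≤ expNeg 1) (s : ℕ) :
    ∀ z : A, z ∈ maximalIdeal A ^ s → V (z : K) ≤ expNeg s := by
  have h1 : ∀ z : A, z ∈ maximalIdeal A → V (z : K) ≤ expNeg 1 := by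
    intro z hz
    rw [← hA.span_eq] at hz
    induction hz using Submodule.span_induction with
    | mem s hs => obtain ⟨k, hk⟩ := hs; rw [← hk]; exact hVu k
    | zero => simp
    | add y z _ _ hy hz => exact (V.map_add _ _).trans (max_le hy hz)
    | smul r z _ hz =>
      rw [smul_eq_mul, MulMemClass.coe_mul, map_mul]
      exact (mul_le_mul' (hVA r r.2) hz).trans_eq (one_mul _)
  induction s with
  | zero => intro z _; rw [expNeg_zero]; exact hVA z z.2
  | succ s ih =>
    intro z hz
    rw [pow_succ] at hz
    induction hz using Submodule.mul_induction_on' with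
    | mem_mul_mem y hy z hz =>
      rw [MulMemClass.coe_mul, map_mul, expNeg_add]
      exact mul_le_mul' (ih y hy) (h1 z hz)
    | add y _ z _ hy hz => exact (V.map_add _ _).trans (max_le hy hz)

end

section

variable {R K ι : Type*} [CommRing R] [Field K] [Algebra R K] {n : ℕ}
  {A : Fin (n + 1) → Subalgebra R K} {u : Fin (n + 1) → ι → K}
  {dir : Fin n → ι}

theorem subalgebra_monotone_of_steps
    (hstep : ∀ i, IsMonomialTransform (A i.castSucc) (u i.castSucc) (A i.succ) (u i.succ) (dir i)) :
    Monotone A :=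
  Fin.monotone_iff_le_succ.mpr fun i => (hstep i).le

variable [∀ i, IsLocalRing (A i)]

theorem isParameters_of_steps (hA : IsParameters (A 0) (u 0))
    (hstep : ∀ i, IsMonomialTransform (A i.castSucc) (u i.castSucc) (A i.succ) (u i.succ) (dir i))
    (i : Fin (n + 1)) : IsParameters (A i) (u i) := by
  induction i using Fin.induction with
  | zero => exact hA
  | succ i ih => exact (hstep i).isParameters ih

theorem valuation_le_one_of_steps {Γ : Type*} [LinearOrderedCommGroupWithZero Γ]
    (hA : IsParameters (A 0) (u 0))
    (hstep : ∀ i, IsMonomialTransform (A i.castSucc) (u i.castSucc) (A i.succ) (u i.succ) (dir i))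
    (V : Valuation K Γ) (hV : ∀ z ∈ A 0, V z ≤ 1) (hVu : ∀ i k, V (u i k) < 1)
    (i : Fin (n + 1)) : ∀ z ∈ A i, V z ≤ 1 := by
  induction i using Fin.induction with
  | zero => exact hV
  | succ i ih => exact (hstep i).valuation_le_one (isParameters_of_steps hA hstep _) V ih (hVu _)

end

theorem isParameters_bot {R K ι : Type*} [CommRing R] [IsLocalRing R] [Field K] [Algebra R K]
    {A : Subalgebra R K} [IsLocalRing A] (hA : A = ⊥) {x : ι → R} {u : ι → K}
    (hx : Ideal.span (Set.range x) = maximalIdeal R) (hu : ∀ k, u k = algebraMap R K (x k))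
    (hinj : Function.Injective (algebraMap R K)) (h0 : ∀ k, u k ≠ 0) : IsParameters A u := by
  have hmem : ∀ r, algebraMap R K r ∈ A := fun r => A.algebraMap_mem r
  have hmax : ∀ r, r ∈ maximalIdeal R → 
      algebraMap R A r ∈ Ideal.span {s : A | (s : K) ∈ Set.range u} := by
    intro r hr
    rw [← hx] at hr
    have h1 := Ideal.mem_map_of_mem (algebraMap R A) hr
    refine (Ideal.map_le_iff_le_comap.mpr (Ideal.span_le.mpr ?_)) h1
    rintro _ ⟨k, rfl⟩
    exact Ideal.subset_span ⟨k, hu k⟩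
  refine ⟨fun k => hu k ▸ hmem _, h0, le_antisymm ?_ ?_⟩
  · rw [Ideal.span_le]
    rintro s ⟨k, hk⟩
    rw [SetLike.mem_coe, mem_maximalIdeal, mem_nonunits_iff, isUnit_iff_exists_inv]
    rintro ⟨z, hz⟩
    have hz2 : (z : K) ∈ (⊥ : Subalgebra R K) := hA ▸ z.2
    obtain ⟨r, hr⟩ := Algebra.mem_bot.mp hz2
    have h1 : algebraMap R K (x k * r) = 1 := by
      rw [map_mul, hr, ← hu, hk]; exact congrArg Subtype.val hz
    have h2 : x k * r = 1 := hinj (h1.trans (map_one _).symm)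
    have hxk : x k ∈ maximalIdeal R := hx ▸ Ideal.subset_span (Set.mem_range_self k)
    exact (mem_maximalIdeal _).mp hxk (isUnit_iff_exists_inv.mpr ⟨r, h2⟩)
  · intro z hz
    have hz2 : (z : K) ∈ (⊥ : Subalgebra R K) := hA ▸ z.2
    obtain ⟨r, hr⟩ := Algebra.mem_bot.mp hz2
    have h1 : z = algebraMap R A r := Subtype.ext hr.symm
    rw [h1]
    refine hmax r ?_
    by_contra hn
    have hru : IsUnit r := by simpa using hn
    exact (mem_maximalIdeal _).mp hz (h1 ▸ hru.map (algebraMap R A))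

end MonomialLQT

end

/-! ### Exponents and weights along the sequence -/

section

open IsLocalRing MvPolynomial

theorem degree_update_add {ι : Type*} [Fintype ι] (b : ι →₀ ℕ) (j : ι) (c : ℕ) :
    (b.update j c).degree + b j = b.degree + c := by
  classical
  rw [Finsupp.degree_eq_sum, Finsupp.degree_eq_sum, Finsupp.coe_update,
    Finset.sum_update_of_mem (Finset.mem_univ j), ← Finset.sum_sdiff (Finset.subset_univ {j}),
    Finset.sum_singleton]
  ring

theorem monomialValue_update {S ι : Type*} [CommMonoid S] [Fintype ι] (v : ι → S) (b : ι →₀ ℕ)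
    (j : ι) (c : ℕ) [DecidableEq ι] :
    monomialValue v (b.update j c) = v j ^ c * ∏ k ∈ Finset.univ.erase j, v k ^ b k := by
  rw [monomialValue, ← Finset.mul_prod_erase _ _ (Finset.mem_univ j)]
  congr 1
  · simp
  · refine Finset.prod_congr rfl fun k hk => ?_
    rw [Finsupp.coe_update, Function.update_of_ne (Finset.ne_of_mem_erase hk)]

/-- Every factor `u k`, including `u j`, contributes exactly one `v j`. -/
theorem monomialValue_eq_update {S ι : Type*} [CommMonoid S] [Fintype ι] {u v : ι → S} {j : ι}
    (hj : u j = v j) (hne : ∀ k, k ≠ j → u k = v k * v j) (b : ι →₀ ℕ) :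
    monomialValue u b = monomialValue v (b.update j b.degree) := by
  classical
  rw [monomialValue_update, monomialValue, ← Finset.mul_prod_erase _ _ (Finset.mem_univ j), hj,
    Finset.prod_congr rfl (g := fun k => v k ^ b k * v j ^ b k) fun k hk => by
      rw [hne k (Finset.ne_of_mem_erase hk), mul_pow],
    Finset.prod_mul_distrib, Finset.prod_pow_eq_pow_sum, Finsupp.degree_eq_sum,
    ← Finset.add_sum_erase _ _ (Finset.mem_univ j), pow_add]
  ac_rfl

theorem monomialValue_mul_pow_eq {S ι : Type*} [CommMonoid S] [Fintype ι] (v : ι → S)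
    (b : ι →₀ ℕ) (j : ι) (c e : ℕ) :
    monomialValue v (b.update j (c + e)) = v j ^ e * monomialValue v (b.update j c) := by
  classical
  rw [monomialValue_update, monomialValue_update, pow_add, mul_comm (v j ^ c), mul_assoc]

section

variable {K ι : Type*} [Field K] [Fintype ι] {n : ℕ} {u : Fin (n + 1) → ι → K} {dir : Fin n → ι}

/-- Dividing out at each step the largest possible power of the exceptional variable, the least
degree of the exponents in `M` drops once every variable has been used as a direction. -/
theorem exists_monomial_factorization
    (hself : ∀ i, u i.succ (dir i) = u i.castSucc (dir i))
    (hne : ∀ i k, k ≠ dir i → u i.castSucc k = u i.succ k * u i.succ (dir i))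
    {M : Finset (ι →₀ ℕ)} {r : ℕ} (hr : ∃ a ∈ M, a.degree = r)
    (i : Fin (n + 1)) :
    ∃ (L : (ι →₀ ℕ) → (ι →₀ ℕ)) (E : ι →₀ ℕ),
      (∀ a ∈ M, monomialValue (u 0) a = monomialValue (u i) E * monomialValue (u i) (L a)) ∧
      (∃ a ∈ M, (L a).degree ≤ r) ∧
      ((∃ a ∈ M, (L a).degree < r) ∨
        ∀ a ∈ M, a.degree = r → L a = a ∧ ∀ i' : Fin n, i'.castSucc < i → a (dir i') = 0) := by
  induction i using Fin.induction with
  | zero =>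
    obtain ⟨a, ha, har⟩ := hr
    refine ⟨id, 0, fun a _ => by simp [monomialValue], ⟨a, ha, har.le⟩, Or.inr fun a _ _ => ⟨rfl, ?_⟩⟩
    intro i' hi'
    exact absurd hi' (Fin.not_lt_zero _)
  | succ i ih =>
    obtain ⟨L, E, hmon, ⟨a₁, ha₁, hle⟩, hor⟩ := ih
    -- After the substitution the exponent at `j` is the former total degree, so `v j ^ ρ` with `ρ`
    -- the least degree can be moved into the common factor `E`.
    obtain ⟨a₀, ha₀, hmin⟩ := M.exists_min_image (fun a => (L a).degree) ⟨a₁, ha₁⟩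
    set ρ := (L a₀).degree
    set j := dir i
    have hτ : ∀ b, monomialValue (u i.castSucc) b = monomialValue (u i.succ) (b.update j b.degree) :=
      monomialValue_eq_update (hself i).symm (hne i)
    have hdrop : (((L a₀).update j ((L a₀).degree - ρ)).degree) + (L a₀) j = ρ := by
      rw [degree_update_add]; omega
    have hρr : ρ ≤ r := (hmin a₁ ha₁).trans hle
    refine ⟨fun a => (L a).update j ((L a).degree - ρ), E.update j E.degree + Finsupp.single j ρ,
      ?_, ⟨a₀, ha₀, by dsimp only; omega⟩, ?_⟩
    · intro a ha
      have h1 : (L a).degree = (L a).degree - ρ + ρ := by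
        have := hmin a ha
        simp only [ρ] at this ⊢; omega
      rw [hmon a ha, hτ E, hτ (L a), monomialValue_add, mul_assoc]
      congr 1
      conv_lhs => rw [h1]
      rw [monomialValue_mul_pow_eq]
      congr 1
      classical
      rw [monomialValue, Finset.prod_eq_single j] <;> simp +contextual [eq_comm]
    · rcases hor with ⟨a, ha, hlt⟩ | hall
      · refine Or.inl ⟨a₀, ha₀, ?_⟩
        have := hmin a ha
        dsimp only at this ⊢; omega
      · by_cases hρ : ρ < r
        · refine Or.inl ⟨a₀, ha₀, ?_⟩
          dsimp only; omega
        -- Now `ρ = r`. An exponent of degree `r` has its entry at `j` replaced by `r - ρ = 0`: its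
        -- degree drops if it involves `j`, and otherwise it is unchanged.
        · by_cases hex : ∃ a ∈ M, a.degree = r ∧ 0 < a j
          · obtain ⟨a, ha, har, haj⟩ := hex
            refine Or.inl ⟨a, ha, ?_⟩
            have h1 := (hall a ha har).1
            have h2 := degree_update_add a j (a.degree - ρ)
            dsimp only
            rw [h1]; omega
          · refine Or.inr fun a ha har => ?_
            obtain ⟨h1, h2⟩ := hall a ha har
            have haj : a j = 0 := by
              by_contra h0
              exact hex ⟨a, ha, har, Nat.pos_of_ne_zero h0⟩
            refine ⟨?_, fun i' hi' => ?_⟩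
            · dsimp only
              have h3 : a.degree - ρ = a j := by omega
              rw [h1, h3, Finsupp.update_self]
            · rcases (Fin.castSucc_lt_succ_iff.mp hi').lt_or_eq with h | h
              · exact h2 i' (Fin.castSucc_lt_castSucc_iff.mpr h)
              · rw [h]; exact haj

/-- Without a drop, an exponent of degree `r` vanishes in every direction, so `r = 0`. The `max r 1`
covers this case, which arises when the expansion of a nonunit has a constant term. -/
theorem exists_monomial_factorization_lt
    (hself : ∀ i, u i.succ (dir i) = u i.castSucc (dir i))
    (hne : ∀ i k, k ≠ dir i → u i.castSucc k = u i.succ k * u i.succ (dir i))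
    (hdir : Function.Surjective dir)
    {M : Finset (ι →₀ ℕ)} {r : ℕ} (hr : ∃ a ∈ M, a.degree = r) :
    ∃ (L : (ι →₀ ℕ) → (ι →₀ ℕ)) (E : ι →₀ ℕ),
      (∀ a ∈ M, monomialValue (u 0) a =
        monomialValue (u (Fin.last n)) E * monomialValue (u (Fin.last n)) (L a)) ∧
      ∃ a ∈ M, (L a).degree < max r 1 := by
  obtain ⟨L, E, hmon, ⟨a₁, ha₁, hle⟩, hor⟩ :=
    exists_monomial_factorization hself hne hr (Fin.last n)
  refine ⟨L, E, hmon, ?_⟩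
  rcases hor with ⟨a, ha, hlt⟩ | hall
  · exact ⟨a, ha, lt_max_of_lt_left hlt⟩
  · obtain ⟨a, ha, har⟩ := hr
    have h0 : a = 0 := by
      ext k
      obtain ⟨i, rfl⟩ := hdir k
      exact (hall a ha har).2 i (Fin.castSucc_lt_last i)
    refine ⟨a₁, ha₁, ?_⟩
    rw [h0, map_zero] at har
    omega

end

namespace MonomialLQT

section

open scoped WithZero

variable {K ι : Type*} [Field K] {n : ℕ}

/-- Weights of all the systems of variables for which those of the last system are `1`. -/
theorem exists_weights (dir : Fin n → ι) :
    ∃ W : Fin (n + 1) → ι → ℕ, (∀ k, W (Fin.last n) k = 1) ∧ (∀ i k, 0 < W i k) ∧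
      (∀ i, W i.castSucc (dir i) = W i.succ (dir i)) ∧
      ∀ i k, k ≠ dir i → W i.castSucc k = W i.succ k + W i.succ (dir i) := by
  classical
  -- The relations `u k = v k * v j` determine the weights backwards from the last system.
  set W : Fin (n + 1) → ι → ℕ := fun i => Fin.reverseInduction (motive := fun _ => ι → ℕ)
    (fun _ => 1) (fun i f k => if k = dir i then f k else f k + f (dir i)) i with hW
  have hlast : W (Fin.last n) = fun _ => 1 := by rw [hW]; exact Fin.reverseInduction_last
  have hcast : ∀ i : Fin n, W i.castSucc =
      fun k => if k = dir i then W i.succ k else W i.succ k + W i.succ (dir i) := fun i => by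
    rw [hW]; exact Fin.reverseInduction_castSucc i
  refine ⟨W, fun k => by rw [hlast], fun i => ?_, fun i => by rw [hcast]; simp,
    fun i k hk => by rw [hcast]; simp [hk]⟩
  induction i using Fin.reverseInduction with
  | last => intro k; rw [hlast]; exact one_pos
  | cast i ih =>
    intro k
    rw [hcast]
    dsimp only
    split_ifs
    · exact ih k
    · exact Nat.add_pos_left (ih k) _

theorem valuation_eq_expNeg {u : Fin (n + 1) → ι → K} {dir : Fin n → ι}
    (hself : ∀ i, u i.succ (dir i) = u i.castSucc (dir i))
    (hne : ∀ i k, k ≠ dir i → u i.castSucc k = u i.succ k * u i.succ (dir i))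
    {W : Fin (n + 1) → ι → ℕ} (hWs : ∀ i, W i.castSucc (dir i) = W i.succ (dir i))
    (hWn : ∀ i k, k ≠ dir i → W i.castSucc k = W i.succ k + W i.succ (dir i))
    (V : Valuation K ℤᵐ⁰) (hV : ∀ k, V (u 0 k) = expNeg (W 0 k)) (i : Fin (n + 1)) :
    ∀ k, V (u i k) = expNeg (W i k) := by
  induction i using Fin.induction with
  | zero => exact hV
  | succ i ih =>
    have hj : V (u i.succ (dir i)) = expNeg (W i.succ (dir i)) := by
      rw [hself, ih, hWs]
    intro k
    by_cases hk : k = dir i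
    · rw [hk, hj]
    · have h1 := ih k
      rw [hne i k hk, hWn i k hk, map_mul, expNeg_add, hj] at h1
      exact mul_right_cancel₀ (expNeg_ne_zero _) h1

theorem valuation_monomialValue [Fintype ι] {u : ι → K} {w : ι → ℕ} (V : Valuation K ℤᵐ⁰)
    (hV : ∀ k, V (u k) = expNeg (w k)) (a : ι →₀ ℕ) :
    V (monomialValue u a) = expNeg (Finsupp.weight w a) := by
  have hpow : ∀ s t : ℕ, expNeg s ^ t = expNeg (t * s) := by
    intro s t
    induction t with
    | zero => simp [expNeg_zero]
    | succ t ih => rw [pow_succ, ih, ← expNeg_add, Nat.succ_mul]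
  have hsum : ∀ (s : Finset ι) (g : ι → ℕ), ∏ k ∈ s, expNeg (g k) = expNeg (∑ k ∈ s, g k) := by
    classical
    intro s g
    induction s using Finset.induction_on with
    | empty => simp [expNeg_zero]
    | insert k s hk ih => rw [Finset.prod_insert hk, Finset.sum_insert hk, ih, expNeg_add]
  rw [monomialValue, map_prod, Finsupp.weight_apply, Finsupp.sum_fintype _ _ (by simp), ← hsum]
  exact Finset.prod_congr rfl fun k _ => by rw [map_pow, hV, hpow, smul_eq_mul]

end

end MonomialLQT

end

/-! ### Prime ideals over the parameters and the cofactor of a monomial -/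

section

open IsLocalRing MvPolynomial

theorem maximalIdeal_pow_le_weightIdeal {R ι : Type*} [CommRing R] [IsLocalRing R] [Fintype ι]
    {x : ι → R} {w : ι → ℕ} (hx : Ideal.span (Set.range x) = maximalIdeal R) (hw : ∀ i, 0 < w i)
    (s : ℕ) : maximalIdeal R ^ s ≤ weightIdeal x w s := by
  induction s with
  | zero => rw [weightIdeal_zero]; exact le_top
  | succ s ih =>
    rw [pow_succ, Ideal.mul_le]
    exact fun f hf g hg => mul_mem_weightIdeal (ih hf) (mem_weightIdeal_one hx hw hg)

theorem parameter_mem {R ι : Type*} [CommRing R] [IsLocalRing R] {x : ι → R}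
    (hx : Ideal.span (Set.range x) = maximalIdeal R) (k : ι) : x k ∈ maximalIdeal R :=
  hx ▸ Ideal.subset_span (Set.mem_range_self k)

section

variable {R ι : Type*} [CommRing R] [IsLocalRing R] [IsNoetherianRing R] [Fintype ι]
  {x : ι → R}

theorem parameter_notMem_sq (hx : Ideal.span (Set.range x) = maximalIdeal R)
    (hdim : (Fintype.card ι : WithBot ℕ∞) ≤ ringKrullDim R) (k : ι) :
    x k ∉ maximalIdeal R ^ 2 := by
  intro h
  have h1 := monomialValue_notMem_weightIdeal hx hdim (w := fun _ => 1) (fun _ => one_pos)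
    (Finsupp.single k 1)
  rw [monomialValue_single, Finsupp.weight_apply, Finsupp.sum_single_index (by simp)] at h1
  exact h1 (maximalIdeal_pow_le_weightIdeal hx (fun _ => one_pos) 2 h)

theorem parameter_ne_zero (hx : Ideal.span (Set.range x) = maximalIdeal R)
    (hdim : (Fintype.card ι : WithBot ℕ∞) ≤ ringKrullDim R) (k : ι) : x k ≠ 0 := fun h =>
  parameter_notMem_sq hx hdim k (h ▸ zero_mem _)

theorem parameter_notMem_span_singleton (hx : Ideal.span (Set.range x) = maximalIdeal R)
    (hdim : (Fintype.card ι : WithBot ℕ∞) ≤ ringKrullDim R) {j k : ι} (hjk : j ≠ k) :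
    x j ∉ Ideal.span {x k} := by
  have := parameter_notMem_span_image hx hdim (T := {k}) (j := j) (by simpa using hjk)
  simpa using this

/-- A parameter is outside the square of the maximal ideal, so the cofactor of `p` in `x k` is a
unit. -/
theorem span_singleton_eq_of_parameter_mem (hx : Ideal.span (Set.range x) = maximalIdeal R)
    (hdim : (Fintype.card ι : WithBot ℕ∞) ≤ ringKrullDim R) {k : ι} {p : R}
    (hp : p ∈ maximalIdeal R) (h : x k ∈ Ideal.span {p}) :
    Ideal.span {p} = Ideal.span {x k} := by
  obtain ⟨c, hc⟩ := Ideal.mem_span_singleton.mp h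
  have hcu : IsUnit c := by
    by_contra hn
    refine parameter_notMem_sq hx hdim k ?_
    rw [hc, pow_two]
    exact Ideal.mul_mem_mul hp hn
  rw [hc, Ideal.span_singleton_mul_right_unit hcu]

end

namespace MonomialLQT

open scoped WithZero

section

variable {R K ι : Type*} [CommRing R] [Field K] [Algebra R K] {n : ℕ}
  {A : Fin (n + 1) → Subalgebra R K} {u : Fin (n + 1) → ι → K} {dir : Fin n → ι}

theorem exists_mul_mem_ideal {B : Subalgebra R K} {q : Ideal B} {y z : K} (hy : y ∈ B)
    (hz : ∃ h : z ∈ B, (⟨z, h⟩ : B) ∈ q) : ∃ h : y * z ∈ B, (⟨y * z, h⟩ : B) ∈ q := by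
  obtain ⟨h, hq⟩ := hz
  exact ⟨mul_mem hy h, Ideal.mul_mem_left q ⟨y, hy⟩ hq⟩

/-- If the contraction to `R` of a prime of the last ring is generated by the variable `x k`, the
direction `k` does not occur. -/
theorem comap_ne_span_of_dir_eq [IsLocalRing R] [IsNoetherianRing R] [Fintype ι]
    {x : ι → R} (hx : Ideal.span (Set.range x) = maximalIdeal R)
    (hdim : (Fintype.card ι : WithBot ℕ∞) ≤ ringKrullDim R)
    (hu : ∀ k, u 0 k = algebraMap R K (x k))
    (hmono : Monotone A) (hmem : ∀ i k, u i k ∈ A i)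
    (hself : ∀ i, u i.succ (dir i) = u i.castSucc (dir i))
    (hne : ∀ i k, k ≠ dir i → u i.castSucc k = u i.succ k * u i.succ (dir i))
    (q : Ideal (A (Fin.last n))) [hq : q.IsPrime] :
    (∀ i k, (∃ h, (⟨u i k, h⟩ : A (Fin.last n)) ∈ q) → x k ∈ q.comap (algebraMap R _)) ∧
    ∀ i₀ : Fin n, (∃ l, l ≠ dir i₀) →
      q.comap (algebraMap R _) ≠ Ideal.span {x (dir i₀)} := by
  classical
  have hT : ∀ i k, u i k ∈ A (Fin.last n) := fun i k => hmono (Fin.le_last i) (hmem i k)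
  have h0 : ∀ k, (∃ h, (⟨u 0 k, h⟩ : A (Fin.last n)) ∈ q) ↔ x k ∈ q.comap (algebraMap R _) := by
    intro k
    have h1 : (⟨u 0 k, hT 0 k⟩ : A (Fin.last n)) = algebraMap R _ (x k) := Subtype.ext (hu k)
    rw [Ideal.mem_comap, ← h1]
    exact ⟨fun ⟨_, h⟩ => h, fun h => ⟨_, h⟩⟩
  have hback : ∀ i k, (∃ h, (⟨u i k, h⟩ : A (Fin.last n)) ∈ q) →
      x k ∈ q.comap (algebraMap R _) := by
    intro i
    induction i using Fin.induction with
    | zero => exact fun k => (h0 k).mp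
    | succ i ih =>
      intro k hk
      refine ih k ?_
      by_cases hkj : k = dir i
      · rw [hkj, ← hself, ← hkj]; exact hk
      · rw [hne i k hkj, mul_comm]; exact exists_mul_mem_ideal (hT _ _) hk
  refine ⟨hback, ?_⟩
  rintro i₀ ⟨l, hl⟩ hcomap
  set k := dir i₀
  -- Until direction `k` is first used, the `k`-th variable stays in `q`: were the exceptional
  -- factor in `q` instead, another parameter would lie in `(x k)`.
  have hfirst : ∀ i : Fin (n + 1), (∀ i' : Fin n, i'.castSucc < i → dir i' ≠ k) →
      ∃ h, (⟨u i k, h⟩ : A (Fin.last n)) ∈ q := by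
    intro i
    induction i using Fin.induction with
    | zero => intro _; rw [h0, hcomap]; exact Ideal.mem_span_singleton_self _
    | succ i ih =>
      intro hi
      obtain ⟨hm, hmq⟩ := ih fun i' hi' => hi i' (hi'.trans (Fin.castSucc_lt_succ))
      have hik : dir i ≠ k := hi i Fin.castSucc_lt_succ
      have h1 : (⟨u i.castSucc k, hm⟩ : A (Fin.last n)) =
          ⟨u i.succ k, hT _ _⟩ * ⟨u i.succ (dir i), hT _ _⟩ := Subtype.ext (hne i k hik.symm)
      rw [h1] at hmq
      rcases hq.mem_or_mem hmq with h | h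
      · exact ⟨_, h⟩
      · exfalso
        have h2 := hback i.succ (dir i) ⟨_, h⟩
        rw [hcomap] at h2
        exact parameter_notMem_span_singleton hx hdim hik h2
  obtain ⟨i₁, hi₁, hmin⟩ := (Finset.univ.filter fun i => dir i = k).exists_min_image id
    ⟨i₀, by simp [k]⟩
  rw [Finset.mem_filter] at hi₁
  have hmq := hfirst i₁.castSucc fun i' hi' hik => by
    have := hmin i' (by simp [hik])
    exact absurd (Fin.castSucc_lt_castSucc_iff.mp hi') (not_lt.mpr this)
  -- At the first use of direction `k`, every other variable becomes a multiple of the `k`-th one in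
  -- the next ring, hence lies in `q`.
  have hlq : ∃ h, (⟨u i₁.castSucc l, h⟩ : A (Fin.last n)) ∈ q := by
    rw [hne i₁ l (by rw [hi₁.2]; exact hl), hself, hi₁.2]
    exact exists_mul_mem_ideal (hT _ _) hmq
  have h2 := hback _ l hlq
  rw [hcomap] at h2
  exact parameter_notMem_span_singleton hx hdim hl h2

/-- After transforms in all directions, a nonzero `f` in the maximal ideal is the product of a
monomial and an element of smaller order. -/
theorem exists_eq_monomialValue_mul [IsLocalRing R] [IsNoetherianRing R] [Fintype ι]
    {x : ι → R} {w : ι → ℕ} (hx : Ideal.span (Set.range x) = maximalIdeal R)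
    (hu : ∀ k, u 0 k = algebraMap R K (x k))
    (hmem : ∀ k, u (Fin.last n) k ∈ A (Fin.last n))
    (hself : ∀ i, u i.succ (dir i) = u i.castSucc (dir i))
    (hne : ∀ i k, k ≠ dir i → u i.castSucc k = u i.succ k * u i.succ (dir i))
    (hdir : Function.Surjective dir) (V : Valuation K ℤᵐ⁰)
    (hVf : ∀ (f : R) (s : ℕ), V (algebraMap R K f) ≤ expNeg s ↔ f ∈ weightIdeal x w s)
    (hVx : ∀ k, V (algebraMap R K (x k)) = expNeg (w k))
    (hVu : ∀ k, V (u (Fin.last n) k) = expNeg 1)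
    {f : R} (hfm : f ∈ maximalIdeal R)
    (hf : ∃ s, V (algebraMap R K f) = expNeg s) :
    ∃ r k : ℕ, k < r ∧ f ∈ maximalIdeal R ^ r ∧ ∃ (E : ι →₀ ℕ) (g : A (Fin.last n)),
      algebraMap R K f = monomialValue (u (Fin.last n)) E * g ∧ V (g : K) = expNeg k := by
  classical
  obtain ⟨s, hs⟩ := hf
  obtain ⟨P, hP, rfl⟩ := exists_eval_eq_of_mem_span_monomialValue ((hVf f s).mp hs.le)
  -- All exponents of `P` have weight at least the value `s` of `f`, so one of them must attain it.
  obtain ⟨a₀, ha₀, hwa₀⟩ : ∃ a ∈ P.support, Finsupp.weight w a = s := by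
    by_contra! hcon
    have h1 : eval x P ∈ weightIdeal x w (s + 1) := eval_mem_weightIdeal fun a ha => by
      have h2 : s ≤ Finsupp.weight w a := hP a ha
      have := hcon a ha
      omega
    have h2 := (hVf _ _).mpr h1
    rw [hs, expNeg_le_iff] at h2
    omega
  obtain ⟨a₂, ha₂, hmin⟩ := P.support.exists_min_image Finsupp.degree ⟨a₀, ha₀⟩
  obtain ⟨L, E, hmon, a₁, ha₁, hlt⟩ :=
    exists_monomial_factorization_lt hself hne hdir (M := P.support) ⟨a₂, ha₂, rfl⟩
  have hu0 : u 0 = fun k => algebraMap R K (x k) := funext hu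
  have hVu0 : ∀ k, V (u 0 k) = expNeg (w k) := fun k => by rw [hu, hVx]
  have hdeg : ∀ a, V (monomialValue (u (Fin.last n)) a) = expNeg a.degree := fun a => by
    rw [Finsupp.degree_eq_weight_one]; exact valuation_monomialValue V hVu a
  -- The last variables have value `1`, so weight and degree of `L a` differ by a constant: `a₀`, of
  -- least weight, also minimizes the degree of `L a`, and this degree is the value of `g`.
  have hwt : ∀ a ∈ P.support, Finsupp.weight w a = E.degree + (L a).degree := fun a ha => by
    apply expNeg_injective
    rw [← valuation_monomialValue V hVu0, hmon a ha, map_mul, hdeg, hdeg, expNeg_add]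
  have hlast : ∀ a, monomialValue (u (Fin.last n)) a ∈ A (Fin.last n) := fun a =>
    prod_mem fun k _ => pow_mem (hmem k) _
  set g : A (Fin.last n) := ∑ a ∈ P.support,
    algebraMap R _ (coeff a P) * ⟨monomialValue (u (Fin.last n)) (L a), hlast _⟩
  have hmap : ∀ a, algebraMap R K (monomialValue x a) = monomialValue (u 0) a := fun a => by
    rw [hu0, monomialValue, monomialValue, map_prod]
    exact Finset.prod_congr rfl fun k _ => map_pow _ _ _
  have hfg : algebraMap R K (eval x P) = monomialValue (u (Fin.last n)) E * g := by
    rw [eval_eq_sum_monomialValue, map_sum, AddSubmonoidClass.coe_finsetSum, Finset.mul_sum]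
    refine Finset.sum_congr rfl fun a ha => ?_
    rw [map_mul, hmap, hmon a ha, MulMemClass.coe_mul]
    change _ = _ * (algebraMap R K (coeff a P) * _)
    ring
  have hVg : V (g : K) = expNeg (L a₀).degree := by
    have h1 := congrArg V hfg
    rw [hs, map_mul, hdeg, ← hwa₀, hwt a₀ ha₀, expNeg_add] at h1
    exact (mul_left_cancel₀ (expNeg_ne_zero _) h1).symm
  refine ⟨max a₂.degree 1, (L a₀).degree, ?_, ?_, E, g, hfg, hVg⟩
  · have h1 : s ≤ Finsupp.weight w a₁ := hP a₁ ha₁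
    rw [hwt a₁ ha₁, ← hwa₀, hwt a₀ ha₀] at h1
    omega
  · rcases le_total a₂.degree 1 with h | h
    · rw [max_eq_right h, pow_one]; exact hfm
    · rw [max_eq_left h, eval_eq_sum_monomialValue]
      exact Ideal.sum_mem _ fun a ha => Ideal.mul_mem_left _ _
        (Ideal.pow_le_pow_right (hmin a ha) (monomialValue_mem_pow hx a))

/-- The cofactor of a monomial in the last variables lies in the transform of a prime when all
directions occur. -/
theorem mem_transformPrime [IsLocalRing R] [IsNoetherianRing R] [Fintype ι] [Nontrivial ι]
    {x : ι → R} (hx : Ideal.span (Set.range x) = maximalIdeal R)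
    (hdim : (Fintype.card ι : WithBot ℕ∞) ≤ ringKrullDim R)
    (hu : ∀ k, u 0 k = algebraMap R K (x k))
    (hmono : Monotone A) (hmem : ∀ i k, u i k ∈ A i)
    (hself : ∀ i, u i.succ (dir i) = u i.castSucc (dir i))
    (hne : ∀ i k, k ≠ dir i → u i.castSucc k = u i.succ k * u i.succ (dir i))
    (hdir : Function.Surjective dir) {p : R} (hp : p ∈ maximalIdeal R) {E : ι →₀ ℕ}
    {g : A (Fin.last n)} (hg : algebraMap R K p = monomialValue (u (Fin.last n)) E * g) :
    g ∈ transformPrime (A (Fin.last n)) (Ideal.span {p}) := by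
  unfold transformPrime
  split_ifs
  · rw [Submodule.mem_sInf]
    rintro q ⟨hq, -, hcomap⟩
    obtain ⟨hback, hdirq⟩ := comap_ne_span_of_dir_eq hx hdim hu hmono hmem hself hne q
    have hlast : ∀ a, monomialValue (u (Fin.last n)) a ∈ A (Fin.last n) := fun a =>
      prod_mem fun k _ => pow_mem (hmem _ k) _
    have hpq : algebraMap R (A (Fin.last n)) p ∈ q := by
      rw [← Ideal.mem_comap, hcomap]; exact Ideal.mem_span_singleton_self p
    have h1 : algebraMap R (A (Fin.last n)) p =
        (∏ k, (⟨u (Fin.last n) k, hmem _ k⟩ : A (Fin.last n)) ^ E k) * g := by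
      apply Subtype.ext
      rw [MulMemClass.coe_mul, SubmonoidClass.coe_finsetProd]
      exact hg
    rw [h1] at hpq
    -- If `q` contained a last variable, `(p)` would be `(x k)`, although direction `k` occurs.
    refine (hq.mem_or_mem hpq).resolve_left fun hprod => ?_
    obtain ⟨k, -, hk⟩ := (hq.prod_mem_iff).mp hprod
    have hkq := hback _ k ⟨_, hq.mem_of_pow_mem _ hk⟩
    rw [hcomap] at hkq
    obtain ⟨i, rfl⟩ := hdir k
    obtain ⟨l, hl⟩ := exists_ne (dir i)
    exact hdirq i ⟨l, hl⟩ (hcomap.trans (span_singleton_eq_of_parameter_mem hx hdim hp hkq))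
  · trivial

end

end MonomialLQT

end

/-! ### Orders and transforms of principal ideals -/

section

open IsLocalRing

namespace MonomialLQT

open scoped nonZeroDivisors

section Order

variable {R : Type*} [CommRing R] [IsLocalRing R]

theorem le_ord {I : Ideal R} {r : ℕ} (h : I ≤ maximalIdeal R ^ r) : (r : ℕ∞) ≤ ord I :=
  le_iSup₂ (f := fun (r : ℕ) (_ : r ∈ {r : ℕ | I ≤ maximalIdeal R ^ r}) => (r : ℕ∞)) r h

theorem ord_le {I : Ideal R} {r : ℕ} (h : ¬ I ≤ maximalIdeal R ^ (r + 1)) : ord I ≤ r := by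
  refine iSup₂_le fun s hs => ?_
  by_contra hlt
  rw [not_le, Nat.cast_lt] at hlt
  exact h (le_trans hs (Ideal.pow_le_pow_right hlt))

end Order

/-- `F` is left free because the same finite index set serves both the primes and their transforms.
-/
theorem finprod_mem_pow_eq_prod {α M : Type*} [CommMonoid M] {s : Set α} {S : Finset α}
    {e : α → ℕ} (hS : ∀ p, p ∈ S ↔ p ∈ s ∧ e p ≠ 0) (F : α → M) :
    ∏ᶠ p ∈ s, F p ^ e p = ∏ p ∈ S, F p ^ e p := by
  refine finprod_mem_eq_prod_of_subset _ ?_ fun p hp => ((hS p).mp hp).1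
  rintro p ⟨hp, hsupp⟩
  refine (hS p).mpr ⟨hp, fun h0 => hsupp ?_⟩
  dsimp only
  rw [h0, pow_zero]

section Factorization

variable {R : Type*} [CommRing R]

theorem mem_principalPrimes_iff {p : Ideal R} :
    p ∈ principalPrimes R ↔ ∃ a : R, Prime a ∧ p = Ideal.span {a} := by
  constructor
  · rintro ⟨hp, ⟨a, ha⟩, h0⟩
    have ha' : p = Ideal.span {a} := ha
    have hne : a ≠ 0 := by
      rintro rfl
      exact h0 (by simp [ha'])
    exact ⟨a, (Ideal.span_singleton_prime hne).mp (ha' ▸ hp), ha'⟩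
  · rintro ⟨a, ha, rfl⟩
    exact ⟨(Ideal.span_singleton_prime ha.ne_zero).mpr ha, ⟨a, rfl⟩,
      by simpa using ha.ne_zero⟩

variable [IsDomain R]

/-- Distinct ideals have nonassociate prime generators, so each power divides the cofactor of the
others. -/
theorem prod_pow_dvd_of_prime {f : R} {S : Finset (Ideal R)} {a : Ideal R → R} {e : Ideal R → ℕ}
    (ha : ∀ p ∈ S, Prime (a p) ∧ p = Ideal.span {a p}) (he : ∀ p ∈ S, a p ^ e p ∣ f) :
    ∏ p ∈ S, a p ^ e p ∣ f := by
  classical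
  induction S using Finset.induction_on with
  | empty => simp
  | insert p S hp ih =>
    obtain ⟨t, ht⟩ := ih (fun p hp => ha p (Finset.mem_insert_of_mem hp))
      (fun p hp => he p (Finset.mem_insert_of_mem hp))
    obtain ⟨hpp, hpe⟩ := ha p (Finset.mem_insert_self p S)
    rw [Finset.prod_insert hp, ht, mul_comm]
    refine mul_dvd_mul_left _ (hpp.pow_dvd_of_dvd_mul_left _ (fun hdvd => ?_)
      (ht ▸ he p (Finset.mem_insert_self p S)))
    obtain ⟨p', hp', hdvd'⟩ := (hpp.dvd_finsetProd_iff _).mp hdvd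
    obtain ⟨hpp', hpe'⟩ := ha p' (Finset.mem_insert_of_mem hp')
    have hass := hpp.associated_of_dvd hpp' (hpp.dvd_of_dvd_pow hdvd')
    rw [hpe, Ideal.span_singleton_eq_span_singleton.mpr hass, ← hpe'] at hp
    exact hp hp'

variable [IsNoetherianRing R]

theorem exponent_spec {f a : R} (hf : f ≠ 0) (ha : Prime a) :
    a ^ exponent (Ideal.span {f}) (Ideal.span {a}) ∣ f ∧
      ¬ a ^ (exponent (Ideal.span {f}) (Ideal.span {a}) + 1) ∣ f := by
  have hiff : ∀ e, Ideal.span {f} ≤ Ideal.span {a} ^ e ↔ a ^ e ∣ f := fun e => by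
    rw [Ideal.span_singleton_pow, Ideal.span_singleton_le_span_singleton]
  set s : Set ℕ := {e | Ideal.span {f} ≤ Ideal.span {a} ^ e}
  -- On an unbounded set `sSup` would take the default value `0`.
  have hbdd : BddAbove s := by
    obtain ⟨N, hN⟩ := FiniteMultiplicity.of_not_isUnit ha.not_isUnit hf
    refine ⟨N, fun e he => ?_⟩
    by_contra hlt
    exact hN ((pow_dvd_pow a (not_le.mp hlt)).trans ((hiff e).mp he))
  refine ⟨(hiff _).mp (Nat.sSup_mem (s := s) ⟨0, by simp [s]⟩ hbdd), fun h => ?_⟩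
  have := le_csSup hbdd ((hiff _).mpr h)
  exact Nat.not_succ_le_self _ this

theorem exponent_pos_iff {f a : R} (hf : f ≠ 0) (ha : Prime a) :
    0 < exponent (Ideal.span {f}) (Ideal.span {a}) ↔ a ∣ f := by
  obtain ⟨h1, h2⟩ := exponent_spec hf ha
  refine ⟨fun h => (dvd_pow_self a h.ne').trans h1, fun h => Nat.pos_of_ne_zero fun h0 => h2 ?_⟩
  rwa [h0, zero_add, pow_one]

/-- A principal prime containing `f` is minimal over `(f)`: a prime between them contains `a` or the
cofactor of the maximal power of `a`, and the latter is not divisible by `a`. -/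
theorem finite_principalPrimes_exponent_ne_zero {f : R} (hf : f ≠ 0) :
    {p ∈ principalPrimes R | exponent (Ideal.span {f}) p ≠ 0}.Finite := by
  refine (Ideal.finite_minimalPrimes_of_isNoetherianRing R (Ideal.span {f})).subset ?_
  rintro p ⟨hp, he⟩
  obtain ⟨a, ha, rfl⟩ := mem_principalPrimes_iff.mp hp
  obtain ⟨⟨t, ht⟩, h2⟩ := exponent_spec hf ha
  set e := exponent (Ideal.span {f}) (Ideal.span {a})
  refine ⟨⟨hp.1, ?_⟩, ?_⟩
  · rw [Ideal.span_singleton_le_span_singleton]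
    exact (exponent_pos_iff hf ha).mp (Nat.pos_of_ne_zero he)
  · rintro q ⟨hq, hfq⟩ hqa
    rw [Ideal.span_singleton_le_iff_mem] at hfq ⊢
    rw [ht] at hfq
    rcases hq.mem_or_mem hfq with h | h
    · exact hq.mem_of_pow_mem _ h
    · exfalso
      obtain ⟨c, rfl⟩ := Ideal.mem_span_singleton.mp (hqa h)
      exact h2 ⟨c, by rw [ht, pow_succ]; ring⟩

theorem mulInv_span_singleton {T : Type*} [CommRing T] [IsDomain T] {g : T} (hg : g ≠ 0) :
    mulInv (Ideal.span {g}) = ⊤ := by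
  rw [Ideal.eq_top_iff_one, mulInv, FractionalIdeal.coeIdeal_span_singleton,
    FractionalIdeal.spanSingleton_mul_inv _ (by simpa using hg)]
  simp

/-- The transform of a nonzero principal ideal is the product of the transforms of its principal
prime divisors. -/
theorem exists_transform_span_singleton_eq (T : Type*) [CommRing T] [IsDomain T] [Algebra R T]
    (hinj : Function.Injective (algebraMap R T)) {f : R} (hf : f ≠ 0) :
    ∃ (S : Finset (Ideal R)) (a : Ideal R → R) (e : Ideal R → ℕ) (g : R),
      (∀ p ∈ S, Prime (a p) ∧ p = Ideal.span {a p} ∧ 0 < e p) ∧ (∀ b, Prime b → b ∣ f → Ideal.span {b} ∈ S) ∧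
      f = (∏ p ∈ S, a p ^ e p) * g ∧
      transform T (Ideal.span {f}) = ∏ p ∈ S, transformPrime T p ^ e p := by
  classical
  have hex : ∀ p : Ideal R, ∃ a : R, p ∈ principalPrimes R → Prime a ∧ p = Ideal.span {a} := by
    intro p
    by_cases hp : p ∈ principalPrimes R
    · obtain ⟨a, ha⟩ := mem_principalPrimes_iff.mp hp
      exact ⟨a, fun _ => ha⟩
    · exact ⟨0, fun h => absurd h hp⟩
  choose a ha using hex
  set e : Ideal R → ℕ := exponent (Ideal.span {f})
  set S := (finite_principalPrimes_exponent_ne_zero hf).toFinset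
  have hS : ∀ p, p ∈ S ↔ p ∈ principalPrimes R ∧ e p ≠ 0 := fun p => by
    rw [Set.Finite.mem_toFinset]; rfl
  have hae : ∀ p ∈ S, Prime (a p) ∧ p = Ideal.span {a p} := fun p hp => ha p ((hS p).mp hp).1
  obtain ⟨g, hg⟩ := prod_pow_dvd_of_prime hae (e := e) (f := f) fun p hp => by
    obtain ⟨h1, h2⟩ := hae p hp
    have := (exponent_spec hf h1).1
    rwa [← h2] at this
  refine ⟨S, a, e, g, fun p hp => ⟨(hae p hp).1, (hae p hp).2,
      Nat.pos_of_ne_zero ((hS p).mp hp).2⟩,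
    fun b hb hbf => ?_, hg, ?_⟩
  · exact (hS _).mpr ⟨mem_principalPrimes_iff.mpr ⟨b, hb, rfl⟩,
      ((exponent_pos_iff hf hb).mpr hbf).ne'⟩
  · set h := ∏ p ∈ S, a p ^ e p
    have hh0 : h ≠ 0 := fun h0 => hf (by rw [hg, h0, zero_mul])
    have hg0 : g ≠ 0 := fun h0 => hf (by rw [hg, h0, mul_zero])
    have hprod : (∏ p ∈ S, p ^ e p) = Ideal.span {h} := by
      rw [← Ideal.prod_span_singleton]
      refine Finset.prod_congr rfl fun p hp => ?_
      rw [← Ideal.span_singleton_pow, ← (hae p hp).2]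
    -- `g` need not be shown to be a unit: a nonzero principal ideal is invertible, so its `mulInv`
    -- is the unit ideal.
    have hres : residualFactor (Ideal.span {f}) = Ideal.span {g} := by
      rw [residualFactor, finprod_mem_pow_eq_prod hS (fun p => p), hprod]
      ext r
      rw [Submodule.mem_colon]
      constructor
      · intro hr
        have h1 := hr h (Ideal.mem_span_singleton_self h)
        rw [smul_eq_mul, Ideal.mem_span_singleton, hg, mul_comm r] at h1
        exact Ideal.mem_span_singleton.mpr ((mul_dvd_mul_iff_left hh0).mp h1)
      · intro hr s hs
        rw [smul_eq_mul, Ideal.mem_span_singleton, hg, mul_comm r]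
        exact mul_dvd_mul (Ideal.mem_span_singleton.mp hs) (Ideal.mem_span_singleton.mp hr)
    have hgT : algebraMap R T g ≠ 0 := fun h0 => hg0 (hinj (h0.trans (map_zero _).symm))
    rw [transform, finprod_mem_pow_eq_prod hS, hres, Ideal.map_span, Set.image_singleton, mulInv_span_singleton hgT,
      Ideal.mul_top]

end Factorization

end MonomialLQT

end

/-! ### A missing direction: raising one weight -/

section

open IsLocalRing

namespace MonomialLQT

open scoped WithZero

section

variable {R K ι : Type*} [CommRing R] [IsLocalRing R] [IsNoetherianRing R] [Fintype ι]
  {x : ι → R}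

/-- The weights `w` with the weight of `l` raised by `N`. -/
def raiseWeight [DecidableEq ι] (w : ι → ℕ) (l : ι) (N : ℕ) (k : ι) : ℕ :=
  w k + if k = l then N else 0

/-- By Krull, `f` is not in `(x l)` plus some power of the maximal ideal. Monomials free of `x l`
have a weight independent of `N`, so the value of `f` stays bounded, whereas that of `x l` tends to
infinity. -/
theorem exists_forall_notMem_weightIdeal_raiseWeight [DecidableEq ι]
    (hx : Ideal.span (Set.range x) = maximalIdeal R) (w : ι → ℕ) {l : ι} {f : R}
    (hf : ¬ x l ∣ f) : ∃ C, ∀ N, f ∉ weightIdeal x (raiseWeight w l N) C := by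
  obtain ⟨t, ht⟩ : ∃ t, f ∉ Ideal.span {x l} ⊔ maximalIdeal R ^ t := by
    by_contra! h
    exact hf (Ideal.mem_span_singleton.mp (Ideal.mem_of_forall_mem_sup_pow_maximalIdeal h))
  refine ⟨(∑ i, w i + 1) * t, fun N hN => ht ((Ideal.span_le.mpr ?_ : weightIdeal x _ _ ≤ _) hN)⟩
  rintro _ ⟨a, ha, rfl⟩
  have ha' : (∑ i, w i + 1) * t ≤ Finsupp.weight (raiseWeight w l N) a := ha
  by_cases hl : a l = 0
  · refine Ideal.mem_sup_right (weightIdeal_le_pow (w := w) hx t (monomialValue_mem_weightIdeal ?_))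
    refine ha'.trans_eq ?_
    rw [Finsupp.weight_apply, Finsupp.weight_apply, Finsupp.sum_fintype _ _ (by simp),
      Finsupp.sum_fintype _ _ (by simp)]
    refine Finset.sum_congr rfl fun k _ => ?_
    by_cases hk : k = l
    · rw [hk, hl, zero_smul, zero_smul]
    · simp [raiseWeight, hk]
  · have hle : Finsupp.single l 1 ≤ a := by rw [Finsupp.single_le_iff]; omega
    rw [monomialValue_eq_mul hle, monomialValue_single]
    exact Ideal.mem_sup_left (Ideal.mul_mem_right _ _ (Ideal.mem_span_singleton_self _))

variable [Field K] [Algebra R K]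

/-- If `x l` divided `f * g` but neither factor, the value of the product would be at least `N` and
yet bounded independently of `N`. -/
theorem prime_parameter [DecidableEq ι] (hx : Ideal.span (Set.range x) = maximalIdeal R)
    (hdim : (Fintype.card ι : WithBot ℕ∞) ≤ ringKrullDim R) {w : ι → ℕ} {l : ι}
    (V : ℕ → Valuation K ℤᵐ⁰)
    (hVf : ∀ N (f : R) (s : ℕ), V N (algebraMap R K f) ≤ expNeg s ↔
      f ∈ weightIdeal x (raiseWeight w l N) s)
    (hVx : ∀ N, V N (algebraMap R K (x l)) ≤ expNeg N)
    (hV0 : ∀ N (f : R), f ≠ 0 → ∃ s, V N (algebraMap R K f) = expNeg s) : Prime (x l) := by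
  refine ⟨parameter_ne_zero hx hdim l, (mem_maximalIdeal _).mp (parameter_mem hx l), ?_⟩
  intro f g hfg
  by_contra! hcon
  obtain ⟨hf, hg⟩ := hcon
  obtain ⟨C₁, hC₁⟩ := exists_forall_notMem_weightIdeal_raiseWeight hx w hf
  obtain ⟨C₂, hC₂⟩ := exists_forall_notMem_weightIdeal_raiseWeight hx w hg
  set N := C₁ + C₂
  obtain ⟨s, hs⟩ := hV0 N f fun h => hf (h ▸ dvd_zero _)
  obtain ⟨t, ht⟩ := hV0 N g fun h => hg (h ▸ dvd_zero _)
  have h1 := hC₁ N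
  have h2 := hC₂ N
  rw [← hVf, hs, expNeg_le_iff] at h1
  rw [← hVf, ht, expNeg_le_iff] at h2
  have h3 : V N (algebraMap R K (f * g)) ≤ expNeg N := by
    obtain ⟨c, hc⟩ := hfg
    rw [hVf, hc]
    exact Ideal.mul_mem_right _ _ ((hVf _ _ _).mp (hVx N))
  rw [map_mul, map_mul, hs, ht, ← expNeg_add, expNeg_le_iff] at h3
  omega

/-- An element that is nonnegative for all the valuations `V N` lies in the localization of `R` at
the prime generated by `x l`. -/
theorem exists_mul_eq_of_forall_valuation_le_one [DecidableEq ι] [IsDomain R] [IsFractionRing R K]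
    (hx : Ideal.span (Set.range x) = maximalIdeal R) {w : ι → ℕ} {l : ι} (hl : Prime (x l))
    (V : ℕ → Valuation K ℤᵐ⁰)
    (hVf : ∀ N (f : R) (s : ℕ), V N (algebraMap R K f) ≤ expNeg s ↔
      f ∈ weightIdeal x (raiseWeight w l N) s)
    (hVx : ∀ N, V N (algebraMap R K (x l)) ≤ expNeg N) {z : K} (hz : ∀ N, V N z ≤ 1) :
    ∃ f g : R, ¬ x l ∣ g ∧ z * algebraMap R K g = algebraMap R K f := by
  have hinj := IsFractionRing.injective R K
  have key : ∀ (j : ℕ) (g f : R), ¬ x l ∣ g →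
      z * algebraMap R K (x l ^ j * g) = algebraMap R K f →
      ∃ f g : R, ¬ x l ∣ g ∧ z * algebraMap R K g = algebraMap R K f := by
    intro j g
    induction j with
    | zero => exact fun f hg h => ⟨f, g, hg, by simpa using h⟩
    | succ j ih =>
      intro f hg h
      -- Since `z` has nonnegative value, `f` has value at least `C` for every `C`; hence one factor
      -- `x l` cancels from the fraction.
      have hf : x l ∣ f := by
        by_contra hf
        obtain ⟨C, hC⟩ := exists_forall_notMem_weightIdeal_raiseWeight hx w hf
        refine hC C ((hVf C f C).mp ?_)
        rw [← h, map_mul]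
        refine (mul_le_of_le_one_left' (hz C)).trans ((hVf _ _ _).mpr ?_)
        rw [pow_succ', mul_assoc]
        exact Ideal.mul_mem_right _ _ ((hVf _ _ _).mp (hVx C))
      obtain ⟨f', rfl⟩ := hf
      refine ih f' hg ?_
      have h0 : algebraMap R K (x l) ≠ 0 := fun h0 =>
        hl.ne_zero (hinj (h0.trans (map_zero _).symm))
      apply mul_left_cancel₀ h0
      rw [← map_mul, ← h, pow_succ', mul_assoc, map_mul _ (x l)]
      ring
  obtain ⟨a, b, hb, rfl⟩ := IsFractionRing.div_surjective (A := R) z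
  have hb0 := nonZeroDivisors.ne_zero hb
  obtain ⟨j, g, hg, rfl⟩ := WfDvdMonoid.max_power_factor hb0 hl.irreducible
  refine key j g a hg (div_mul_cancel₀ _ fun h0 => hb0 (hinj (h0.trans (map_zero _).symm)))

end

/-! ### The height-one prime of the last ring over a principal prime -/

section

variable {R K : Type*} [CommRing R] [Field K] [Algebra R K]
  [IsFractionRing R K] {T : Subalgebra R K} {p : R}

/-- The center on `T` of the localization of `R` at the prime generated by `p`. -/
def centerIdeal (T : Subalgebra R K) (hp : Prime p)
    (hT : ∀ z ∈ T, ∃ f g : R, ¬ p ∣ g ∧ z * algebraMap R K g = algebraMap R K f) : Ideal T where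
  carrier := {z | ∃ f g : R, ¬ p ∣ g ∧ p ∣ f ∧ (z : K) * algebraMap R K g = algebraMap R K f}
  zero_mem' := ⟨0, 1, fun h => hp.not_isUnit (isUnit_of_dvd_one h), dvd_zero _, by simp⟩
  add_mem' := by
    rintro y z ⟨f, g, hg, hf, h⟩ ⟨f', g', hg', hf', h'⟩
    refine ⟨f * g' + f' * g, g * g', hp.not_dvd_mul hg hg',
      dvd_add (hf.mul_right _) (hf'.mul_right _), ?_⟩
    rw [map_add, map_mul, map_mul, map_mul, ← h, ← h', AddMemClass.coe_add]
    ring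
  smul_mem' := by
    rintro c z ⟨f, g, hg, hf, h⟩
    obtain ⟨f', g', hg', h'⟩ := hT c c.2
    refine ⟨f' * f, g' * g, hp.not_dvd_mul hg' hg, hf.mul_left _, ?_⟩
    rw [map_mul, map_mul, ← h, ← h', smul_eq_mul, MulMemClass.coe_mul]
    ring

variable {hp : Prime p}
  {hT : ∀ z ∈ T, ∃ f g : R, ¬ p ∣ g ∧ z * algebraMap R K g = algebraMap R K f}

theorem algebraMap_mem_centerIdeal_iff {r : R} :
    algebraMap R T r ∈ centerIdeal T hp hT ↔ p ∣ r := by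
  constructor
  · rintro ⟨f, g, hg, hf, h⟩
    have h1 : r * g = f := IsFractionRing.injective R K (by rw [map_mul]; exact h)
    exact (hp.dvd_or_dvd (h1 ▸ hf)).resolve_right hg
  · intro hr
    exact ⟨r, 1, fun h => hp.not_isUnit (isUnit_of_dvd_one h), hr, by rw [map_one, mul_one]; rfl⟩

theorem isPrime_centerIdeal : (centerIdeal T hp hT).IsPrime := by
  refine ⟨fun h => ?_, ?_⟩
  · have h1 : algebraMap R T 1 ∈ centerIdeal T hp hT := h ▸ trivial
    exact hp.not_isUnit (isUnit_of_dvd_one (algebraMap_mem_centerIdeal_iff.mp h1))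
  · rintro y z ⟨f, g, hg, hf, h⟩
    obtain ⟨fy, gy, hgy, hy⟩ := hT y y.2
    obtain ⟨fz, gz, hgz, hz⟩ := hT z z.2
    have h1 : fy * fz * g = f * (gy * gz) := by
      apply IsFractionRing.injective R K
      rw [map_mul, map_mul, map_mul, map_mul, ← h, ← hy, ← hz, MulMemClass.coe_mul]
      ring
    have h2 : p ∣ fy * fz :=
      (hp.dvd_or_dvd (h1 ▸ hf.mul_right _ : p ∣ fy * fz * g)).resolve_right hg
    rcases hp.dvd_or_dvd h2 with h3 | h3
    · exact Or.inl ⟨fy, gy, hgy, h3, hy⟩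
    · exact Or.inr ⟨fz, gz, hgz, h3, hz⟩

theorem comap_centerIdeal :
    (centerIdeal T hp hT).comap (algebraMap R T) = Ideal.span {p} := by
  ext r
  rw [Ideal.mem_comap, algebraMap_mem_centerIdeal_iff, Ideal.mem_span_singleton]

variable [IsDomain R] [IsNoetherianRing R]

/-- Strip the powers of `p` from the numerator of a nonzero element of a prime `q` strictly inside
the center: since `q` contracts into `(p)`, it must contain `p`. Then it contains the whole center,
because denominators prime to `p` are outside `q`. -/
theorem height_centerIdeal : (centerIdeal T hp hT).height = 1 := by
  have hprime := isPrime_centerIdeal (hp := hp) (hT := hT)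
  apply le_antisymm
  · refine (Ideal.height_le_iff (n := 1)).mpr fun q hq hlt => ?_
    have hbot : q = ⊥ := by
      by_contra hne
      obtain ⟨z, hzq, hz0⟩ := Submodule.exists_mem_ne_zero_of_ne_bot hne
      have hsub : ∀ r : R, algebraMap R T r ∈ q → p ∣ r := fun r hr =>
        algebraMap_mem_centerIdeal_iff.mp (hlt.le hr)
      obtain ⟨f, g, hg, h⟩ := hT z z.2
      have hzg : z * algebraMap R T g = algebraMap R T f := Subtype.ext h
      have hf0 : f ≠ 0 := by
        rintro rfl
        rw [map_zero] at h
        rcases mul_eq_zero.mp h with h1 | h1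
        · exact hz0 (Subtype.ext h1)
        · refine hg ?_
          rw [IsFractionRing.injective R K (h1.trans (map_zero _).symm)]
          exact dvd_zero _
      have hfq : algebraMap R T f ∈ q := hzg ▸ Ideal.mul_mem_right _ _ hzq
      obtain ⟨e, f', hf', rfl⟩ := WfDvdMonoid.max_power_factor hf0 hp.irreducible
      rw [map_mul, map_pow] at hfq
      have hpq : algebraMap R T p ∈ q := hq.mem_of_pow_mem _
        ((hq.mem_or_mem hfq).resolve_right fun h1 => hf' (hsub _ h1))
      refine hlt.not_ge ?_
      rintro y ⟨f₁, g₁, hg₁, ⟨c, rfl⟩, hy⟩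
      have hyg : y * algebraMap R T g₁ = algebraMap R T p * algebraMap R T c := by
        rw [← map_mul]; exact Subtype.ext hy
      exact (hq.mem_or_mem (hyg ▸ Ideal.mul_mem_right _ _ hpq)).resolve_right
        fun h1 => hg₁ (hsub _ h1)
    rw [hbot, Ideal.height_bot]
    exact_mod_cast one_pos
  · rw [Order.one_le_iff_ne_zero, Ne, Ideal.height_eq_zero_iff,
      IsDomain.minimalPrimes_eq_singleton_bot, Set.mem_singleton_iff]
    intro h
    have h1 : algebraMap R T p ∈ centerIdeal T hp hT := algebraMap_mem_centerIdeal_iff.mpr dvd_rfl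
    rw [h, Ideal.mem_bot] at h1
    exact hp.ne_zero (IsFractionRing.injective R K ((congrArg Subtype.val h1).trans
      (map_zero _).symm))

/-- The center both witnesses the condition `pT ∩ R = p` and is one of the primes being intersected.
-/
theorem transformPrime_le_centerIdeal :
    transformPrime T (Ideal.span {p}) ≤ centerIdeal T hp hT := by
  have hle : (Ideal.span {p}).map (algebraMap R T) ≤ centerIdeal T hp hT :=
    Ideal.map_le_iff_le_comap.mpr comap_centerIdeal.ge
  have hcond : ((Ideal.span {p}).map (algebraMap R T)).comap (algebraMap R T) = Ideal.span {p} :=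
    le_antisymm ((Ideal.comap_mono hle).trans comap_centerIdeal.le) Ideal.le_comap_map
  rw [transformPrime, if_pos hcond]
  exact sInf_le ⟨isPrime_centerIdeal, height_centerIdeal, comap_centerIdeal⟩

end

end MonomialLQT

end

/-! ### The two implications -/

section

open IsLocalRing

namespace MonomialLQT

open scoped WithZero

theorem valuation_le_one_of_eq_bot {R K : Type*} [CommRing R] [Field K] [Algebra R K]
    {Γ : Type*} [LinearOrderedCommGroupWithZero Γ] {B : Subalgebra R K} (hB : B = ⊥) (V : Valuation K Γ)
    (hV : ∀ f : R, V (algebraMap R K f) ≤ 1) : ∀ z ∈ B, V z ≤ 1 := by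
  intro z hz
  rw [hB] at hz
  obtain ⟨r, rfl⟩ := Algebra.mem_bot.mp hz
  exact hV r

section

variable {R K : Type*} [CommRing R] [IsLocalRing R] [IsNoetherianRing R]
  [Field K] [Algebra R K] [IsFractionRing R K] {ι : Type*} [Fintype ι] {n : ℕ}
  {x : ι → R} {A : Fin (n + 1) → Subalgebra R K} [∀ i, IsLocalRing (A i)]
  {u : Fin (n + 1) → ι → K} {dir : Fin n → ι}

theorem isParameters_zero (hx : Ideal.span (Set.range x) = maximalIdeal R)
    (hdim : (Fintype.card ι : WithBot ℕ∞) ≤ ringKrullDim R) (hA : A 0 = ⊥)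
    (hu : ∀ k, u 0 k = algebraMap R K (x k)) : IsParameters (A 0) (u 0) := by
  have hinj := IsFractionRing.injective R K
  refine isParameters_bot hA hx hu hinj fun k h0 => parameter_ne_zero hx hdim k ?_
  rw [hu] at h0
  exact hinj (h0.trans (map_zero _).symm)

variable [IsDomain R]

/-- If all directions occur, the order of the transform of `f` is less than the order of `f`. -/
theorem ord_transform_lt [Nontrivial ι] (hx : Ideal.span (Set.range x) = maximalIdeal R)
    (hdim : (Fintype.card ι : WithBot ℕ∞) ≤ ringKrullDim R) (hA : A 0 = ⊥)
    (hu : ∀ k, u 0 k = algebraMap R K (x k))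
    (hstep : ∀ i, IsMonomialTransform (A i.castSucc) (u i.castSucc) (A i.succ) (u i.succ) (dir i))
    (hdir : Function.Surjective dir) {f : R} (hf : f ≠ 0) (hfm : f ∈ maximalIdeal R) :
    ord (transform (A (Fin.last n)) (Ideal.span {f})) < ord (Ideal.span {f}) := by
  have hA0 := isParameters_zero hx hdim hA hu
  have hpar := isParameters_of_steps hA0 hstep
  have hself : ∀ i, u i.succ (dir i) = u i.castSucc (dir i) := fun i => (hstep i).apply_self
  have hne : ∀ i k, k ≠ dir i → u i.castSucc k = u i.succ k * u i.succ (dir i) :=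
    fun i k hk => (hstep i).mul_eq ((hpar _).ne_zero _) hk
  obtain ⟨W, hWlast, hWpos, hWs, hWn⟩ := exists_weights dir
  obtain ⟨V, hVf, hVx, hV0⟩ := exists_monomialValuation K hx hdim (hWpos 0)
  have hVu := valuation_eq_expNeg hself hne hWs hWn V (fun k => by rw [hu, hVx])
  have hVA := valuation_le_one_of_steps hA0 hstep V
    (valuation_le_one_of_eq_bot hA V fun f => by
      rw [← expNeg_zero, hVf, weightIdeal_zero]; trivial)
    (fun i k => by rw [hVu, ← expNeg_zero, expNeg_lt_iff]; exact hWpos i k) (Fin.last n)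
  have hVlast : ∀ k, V (u (Fin.last n) k) = expNeg 1 := fun k => by rw [hVu, hWlast]
  obtain ⟨S, a, e, g, hS, -, hfg, htr⟩ := exists_transform_span_singleton_eq (A (Fin.last n))
    (fun y z h => IsFractionRing.injective R K (congrArg Subtype.val h)) hf
  have hex : ∀ p : Ideal R, ∃ (r k : ℕ) (b : A (Fin.last n)), p ∈ S → k < r ∧
      a p ∈ maximalIdeal R ^ r ∧ b ∈ transformPrime (A (Fin.last n)) p ∧ V (b : K) = expNeg k := by
    intro p
    by_cases hp : p ∈ S
    · obtain ⟨hprime, hpa, -⟩ := hS p hp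
      have ham : a p ∈ maximalIdeal R := (mem_maximalIdeal _).mpr hprime.not_isUnit
      obtain ⟨r, k, hkr, har, E, b, hb, hVb⟩ := exists_eq_monomialValue_mul hx hu (hpar _).mem
        hself hne hdir V hVf hVx hVlast ham (hV0 _ hprime.ne_zero)
      have hmem := mem_transformPrime hx hdim hu (subalgebra_monotone_of_steps hstep)
        (fun i => (hpar i).mem) hself hne hdir ham hb
      exact ⟨r, k, b, fun _ => ⟨hkr, har, by rw [hpa]; exact hmem, hVb⟩⟩
    · exact ⟨0, 0, 0, fun h => absurd h hp⟩
  choose r k b hb using hex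
  have hpow : ∀ p ∈ S, V ((b p : K) ^ e p) = expNeg (e p * k p) := by
    intro p hp
    rw [map_pow, (hb p hp).2.2.2]
    induction e p with
    | zero => simp [expNeg_zero]
    | succ t ih => rw [pow_succ, ih, ← expNeg_add, Nat.succ_mul]
  have hsum : ∀ (S' : Finset (Ideal R)), S' ⊆ S →
      V (∏ p ∈ S', (b p : K) ^ e p) = expNeg (∑ p ∈ S', e p * k p) := by
    classical
    intro S'
    induction S' using Finset.induction_on with
    | empty => simp [expNeg_zero]
    | insert p S' hp ih =>
      intro hsub
      rw [Finset.prod_insert hp, Finset.sum_insert hp, map_mul, expNeg_add,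
        ih ((Finset.subset_insert p S').trans hsub), hpow p (hsub (Finset.mem_insert_self p S'))]
  have hmem : (∏ p ∈ S, b p ^ e p) ∈ transform (A (Fin.last n)) (Ideal.span {f}) := by
    rw [htr]
    exact Ideal.prod_mem_prod fun p hp => Ideal.pow_mem_pow (hb p hp).2.2.1 _
  -- The product of the cofactors lies in the transform, and its value bounds the order from above.
  have hupper : ord (transform (A (Fin.last n)) (Ideal.span {f})) ≤ (∑ p ∈ S, e p * k p : ℕ) := by
    refine ord_le fun hle => ?_
    have h1 := valuation_le_expNeg_of_mem_pow (hpar _) V hVA (fun k => (hVlast k).le) _ _ (hle hmem)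
    rw [SubmonoidClass.coe_finsetProd] at h1
    have h2 := (hsum S subset_rfl).symm.trans_le h1
    rw [expNeg_le_iff] at h2
    omega
  refine hupper.trans_lt ?_
  -- Factoriality of `R` is not invoked, so the case without prime factors is settled by `f ∈ 𝔪`.
  rcases S.eq_empty_or_nonempty with hemp | hnemp
  · rw [hemp, Finset.sum_empty]
    refine lt_of_lt_of_le ?_ (le_ord (r := 1) ?_)
    · exact_mod_cast one_pos
    · rwa [pow_one, Ideal.span_singleton_le_iff_mem]
  · refine lt_of_lt_of_le ?_ (le_ord (r := ∑ p ∈ S, e p * r p) ?_)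
    · rw [Nat.cast_lt]
      exact Finset.sum_lt_sum_of_nonempty hnemp fun p hp =>
        Nat.mul_lt_mul_of_pos_left (hb p hp).1 (hS p hp).2.2
    · rw [Ideal.span_singleton_le_iff_mem, hfg]
      refine Ideal.mul_mem_right _ _ ?_
      rw [← Finset.prod_pow_eq_pow_sum]
      refine Ideal.prod_mem_prod fun p hp => ?_
      rw [mul_comm, pow_mul]
      exact Ideal.pow_mem_pow (hb p hp).2.1 _

/-- If the direction `l` does not occur, the transform of the variable `x l` is not the unit
ideal. -/
theorem exists_le_ord_transform (hx : Ideal.span (Set.range x) = maximalIdeal R)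
    (hdim : (Fintype.card ι : WithBot ℕ∞) ≤ ringKrullDim R) (hA : A 0 = ⊥)
    (hu : ∀ k, u 0 k = algebraMap R K (x k))
    (hstep : ∀ i, IsMonomialTransform (A i.castSucc) (u i.castSucc) (A i.succ) (u i.succ) (dir i))
    {l : ι} (hl : ∀ i, dir i ≠ l) :
    ord (Ideal.span {x l}) ≤ ord (transform (A (Fin.last n)) (Ideal.span {x l})) := by
  classical
  have hA0 := isParameters_zero hx hdim hA hu
  have hpar := isParameters_of_steps hA0 hstep
  have hself : ∀ i, u i.succ (dir i) = u i.castSucc (dir i) := fun i => (hstep i).apply_self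
  have hne : ∀ i k, k ≠ dir i → u i.castSucc k = u i.succ k * u i.succ (dir i) :=
    fun i k hk => (hstep i).mul_eq ((hpar _).ne_zero _) hk
  obtain ⟨W, -, hWpos, hWs, hWn⟩ := exists_weights dir
  have hpos : ∀ N i k, 0 < raiseWeight (W i) l N k := fun N i k => Nat.add_pos_left (hWpos i k) _
  choose V hVf hVx hV0 using fun N => exists_monomialValuation K hx hdim (hpos N 0)
  -- Raising the weight of `l` alone preserves the recursion, since the weight added at each step is
  -- that of a direction, never `l`.
  have hVu := fun N => valuation_eq_expNeg (W := fun i => raiseWeight (W i) l N) hself hne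
    (fun i => by simp [raiseWeight, hl i, hWs])
    (fun i k hk => by simp only [raiseWeight, hWn i k hk, if_neg (hl i)]; omega)
    (V N) (fun k => by rw [hu, hVx])
  have hVA := fun N => valuation_le_one_of_steps hA0 hstep (V N)
    (valuation_le_one_of_eq_bot hA (V N) fun f => by
      rw [← expNeg_zero, hVf, weightIdeal_zero]; trivial)
    (fun i k => by rw [hVu, ← expNeg_zero, expNeg_lt_iff]; exact hpos N i k) (Fin.last n)
  have hVl : ∀ N, V N (algebraMap R K (x l)) ≤ expNeg N := fun N => by
    rw [hVx, expNeg_le_iff]; simp [raiseWeight]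
  have hprime : Prime (x l) := prime_parameter hx hdim V hVf hVl hV0
  have hT : ∀ z ∈ A (Fin.last n), ∃ f g : R, ¬ x l ∣ g ∧ z * algebraMap R K g = algebraMap R K f :=
    fun z hz => exists_mul_eq_of_forall_valuation_le_one hx hprime V hVf hVl fun N => hVA N z hz
  obtain ⟨S, a, e, g, hS, hSmem, -, htr⟩ := exists_transform_span_singleton_eq (A (Fin.last n))
    (fun y z h => IsFractionRing.injective R K (congrArg Subtype.val h)) hprime.ne_zero
  have hlS := hSmem (x l) hprime dvd_rfl
  have hle : transform (A (Fin.last n)) (Ideal.span {x l}) ≤ maximalIdeal (A (Fin.last n)) := by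
    rw [htr, ← Finset.mul_prod_erase S _ hlS]
    refine Ideal.mul_le_left.trans ((Ideal.pow_le_self (hS _ hlS).2.2.ne').trans ?_)
    exact (transformPrime_le_centerIdeal (hp := hprime) (hT := hT)).trans
      (le_maximalIdeal isPrime_centerIdeal.ne_top)
  refine (ord_le (r := 1) ?_).trans (le_ord (r := 1) (by rwa [pow_one]))
  rw [Ideal.span_singleton_le_iff_mem]
  exact parameter_notMem_sq hx hdim l

end

end MonomialLQT

end

theorem theorem3 {R K : Type*} [CommRing R] [IsDomain R] [IsRegularLocalRing R]
    [Field K] [Algebra R K] [IsFractionRing R K]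
    (d n : ℕ) (hd : 2 ≤ d) (hn : 0 < n) (hdim : ringKrullDim R = d)
    (x : Fin d → R) (hx : Ideal.span (Set.range x) = IsLocalRing.maximalIdeal R)
    (A : Fin (n + 1) → Subalgebra R K) [∀ i, IsLocalRing (A i)]
    (u : Fin (n + 1) → Fin d → K)
    (hA : A 0 = ⊥) (hu : ∀ k, u 0 k = algebraMap R K (x k))
    (hstep : ∀ i : Fin n, ∃ j : Fin d, MonomialLQT.IsMonomialTransform
      (A i.castSucc) (u i.castSucc) (A i.succ) (u i.succ) j) :
    (∀ j : Fin d, (MonomialLQT.directionSet A u j).Nonempty) ↔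
      ∀ f : R, f ≠ 0 → f ∈ IsLocalRing.maximalIdeal R →
        MonomialLQT.ord (MonomialLQT.transform (A (Fin.last n)) (Ideal.span {f})) <
          MonomialLQT.ord (Ideal.span {f}) := by
  have hdim' : (Fintype.card (Fin d) : WithBot ℕ∞) ≤ ringKrullDim R := by
    rw [hdim, Fintype.card_fin]
  have : Nontrivial (Fin d) := Fin.nontrivial_iff_two_le.mpr hd
  choose dir hdir using hstep
  constructor
  · intro hne f hf hfm
    refine MonomialLQT.ord_transform_lt hx hdim' hA hu hdir (fun j => ?_) hf hfm
    obtain ⟨i, hi⟩ := hne j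
    refine ⟨i, ?_⟩
    by_contra hij
    -- The direction of a step is unique: if `j ≠ dir i` were also one, the variable `u i.succ (dir
    -- i)` would be `1`, yet lie in the maximal ideal.
    have hpar := MonomialLQT.isParameters_of_steps
      (MonomialLQT.isParameters_zero hx hdim' hA hu) hdir
    have hi' : MonomialLQT.IsMonomialTransform (A i.castSucc) (u i.castSucc) (A i.succ)
        (u i.succ) j := hi
    have h1 : u i.succ j * u i.succ (dir i) = u i.succ j := by
      rw [← (hdir i).mul_eq ((hpar _).ne_zero _) (Ne.symm hij), hi'.apply_self]
    have h2 : u i.succ (dir i) = 1 := mul_left_cancel₀ ((hpar i.succ).ne_zero j)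
      (h1.trans (mul_one _).symm)
    have h3 : (1 : A i.succ) ∈ IsLocalRing.maximalIdeal (A i.succ) := by
      rw [← (hpar i.succ).span_eq]
      exact Ideal.subset_span ⟨dir i, h2⟩
    exact (IsLocalRing.mem_maximalIdeal _).mp h3 isUnit_one
  · intro h l
    by_contra hemp
    refine (h (x l) (parameter_ne_zero hx hdim' l) (parameter_mem hx l)).not_ge ?_
    refine MonomialLQT.exists_le_ord_transform hx hdim' hA hu hdir fun i hi => hemp ⟨i, ?_⟩
    have := hdir i
    rw [hi] at this
    exact this
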